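/- Let $\mathbb T=\mathbb R/T\mathbb Z$ with $T>0$, let $\mu$ be the normalized Lebesgue measure on $\mathbb T$ and $d\nu=(2\pi)^{-1/2}e^{-v^2/2}\,dv$ on $\mathbb R$, and let $\|\cdot\|$ be the norm of the real space $L^2=L^2(\mathbb T\times\mathbb R,d\mu\,d\nu)$. Consider the Fokker–Planck equation with $V=0$, $$\partial_t f+v\,\partial_x f=-(-\partial_v+v)\partial_v f,\qquad f|_{t=0}=f_0, \qquad \text{(FP)}$$ and let $P=v\,\partial_x+(-\partial_v+v)\partial_v$ be the operator on $L^2$ with domain $D(P)=\{f\in L^2: Pf\in L^2\text{ in the sense of distributions}\}$. Then $-P$ generates a strongly continuous semigroup $(e^{-tP})_{t\ge 0}$ on $L^2$; the solution of (FP) with initial datum $f_0\in L^2$ is $f(t)=e^{-tP}f_0$. **Theorem 1.2.** There exists a constant $C>0$ (independent of $f_0$) such that for every $f_0\in L^2$ the solution $f$ of (FP) satisfies $f(t)\in H^1$ for all $t>0$, where $H^1=\{g\in L^2:\partial_x g,\partial_v g\in L^2\text{ in the sense of distributions}\}$, and for all $t\in(0,1]$, $$\|\partial_v f(t)\|\le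 \frac{C}{t^{1/2}}\|f_0\|,\qquad \|\partial_x f(t)\|\le \frac{C}{t^{3/2}}\|f_0\|.$$ -/

import Mathlib

open MeasureTheory Filter Topology
open scoped ContDiff

noncomputable section

namespace FokkerPlanck

/-- The probability measure `dμ dν` on `𝕋 × ℝ`: `μ` is the normalized Lebesgue (Haar) measure on the
circle `𝕋 = ℝ / Tℤ` (this is `e^{-V} dx / ∫ e^{-V} dx` for `V = 0`) and `ν` is the standard Gaussian
`(2π)^{-1/2} e^{-v²/2} dv` in velocity. -/
def maxwellian (T : ℝ) [Fact (0 < T)] : Measure (AddCircle T × ℝ) :=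
  (AddCircle.haarAddCircle (T := T)).prod (ProbabilityTheory.gaussianReal 0 1)

/-- The real Hilbert space `L²(dμ dν)` on `𝕋 × ℝ`. -/
abbrev L2 (T : ℝ) [Fact (0 < T)] : Type := Lp ℝ 2 (maxwellian T)

/-- Test functions: smooth (i.e. with smooth lift to `ℝ × ℝ`) compactly supported functions on
`𝕋 × ℝ`. -/
structure IsTest {T : ℝ} (φ : AddCircle T × ℝ → ℝ) : Prop where
  smooth : ContDiff ℝ ∞ (fun p : ℝ × ℝ => φ ((p.1 : AddCircle T), p.2))
  compact : HasCompactSupport φ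

/-- The classical partial derivative `∂ₓφ` on `𝕋 × ℝ`. -/
def dx {T : ℝ} (φ : AddCircle T × ℝ → ℝ) (p : AddCircle T × ℝ) : ℝ :=
  deriv (fun s : ℝ => φ (p.1 + (s : AddCircle T), p.2)) 0

/-- The classical partial derivative `∂ᵥφ` on `𝕋 × ℝ`. -/
def dv {T : ℝ} (φ : AddCircle T × ℝ → ℝ) (p : AddCircle T × ℝ) : ℝ :=
  deriv (fun w : ℝ => φ (p.1, w)) p.2

/-- The operator `(-∂ᵥ + v) φ`, the formal adjoint of `∂ᵥ` in `L²(dμ dν)`. -/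
def dvAdj {T : ℝ} (φ : AddCircle T × ℝ → ℝ) (p : AddCircle T × ℝ) : ℝ :=
  - dv φ p + p.2 * φ p

/-- The formal adjoint `P* = - v ∂ₓ + (-∂ᵥ + v) ∂ᵥ` in `L²(dμ dν)` of the Fokker-Planck operator
`P = v ∂ₓ + (-∂ᵥ + v) ∂ᵥ`, acting on test functions. -/
def fpAdj {T : ℝ} (φ : AddCircle T × ℝ → ℝ) (p : AddCircle T × ℝ) : ℝ :=
  - (p.2 * dx φ p) + dvAdj (dv φ) p

variable {T : ℝ} [Fact (0 < T)]

/-- `g = ∂ₓ f` in the sense of distributions on `𝕋 × ℝ`. (Pairing against `φ dμ dν` is pairing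
against the test function `φ ν` for `dx dv`; since the Gaussian `ν` is smooth and positive and does
not depend on `x`, all test functions are obtained in this way.) -/
def IsWeakDx (f g : L2 T) : Prop :=
  ∀ φ : AddCircle T × ℝ → ℝ, IsTest φ →
    ∫ p, f p * (- dx φ p) ∂(maxwellian T) = ∫ p, g p * φ p ∂(maxwellian T)

/-- `g = ∂ᵥ f` in the sense of distributions on `𝕋 × ℝ`. (With respect to `dμ dν` the derivative
falls on `φ ν`, and `- ∂ᵥ(φ ν) = ν (-∂ᵥ + v) φ`.) -/
def IsWeakDv (f g : L2 T) : Prop :=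
  ∀ φ : AddCircle T × ℝ → ℝ, IsTest φ →
    ∫ p, f p * dvAdj φ p ∂(maxwellian T) = ∫ p, g p * φ p ∂(maxwellian T)

/-- `f ∈ H¹(dμ dν)`: both distributional first order derivatives of `f` are in `L²(dμ dν)`. -/
def MemH1 (f : L2 T) : Prop :=
  (∃ g : L2 T, IsWeakDx f g) ∧ (∃ g : L2 T, IsWeakDv f g)

/-- The graph of the Fokker-Planck operator `P = v ∂ₓ + (-∂ᵥ + v) ∂ᵥ` on `L²(dμ dν)`, with domain
`D(P) = {f ∈ L² : P f ∈ L² in the sense of distributions}`: `IsFP f g` means `f ∈ D(P)` and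
`P f = g`. -/
def IsFP (f g : L2 T) : Prop :=
  ∀ φ : AddCircle T × ℝ → ℝ, IsTest φ →
    ∫ p, f p * fpAdj φ p ∂(maxwellian T) = ∫ p, g p * φ p ∂(maxwellian T)

/-- `S` (of which only the values at times `t ≥ 0` matter) is a strongly continuous semigroup of
bounded operators on `L²(dμ dν)` whose infinitesimal generator is exactly `-P`, domain included.
In other words `S t = e^{-tP}`, so `t ↦ S t f₀` is the solution of
`∂ₜ f + v ∂ₓ f = -(-∂ᵥ + v) ∂ᵥ f` with initial datum `f₀`. -/
structure IsFPSemigroup (S : ℝ → L2 T →L[ℝ] L2 T) : Prop where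
  zero : S 0 = ContinuousLinearMap.id ℝ (L2 T)
  add : ∀ s t : ℝ, 0 ≤ s → 0 ≤ t → S (s + t) = (S s).comp (S t)
  continuous : ∀ f : L2 T, Tendsto (fun t : ℝ => S t f) (𝓝[>] 0) (𝓝 f)
  generator : ∀ f g : L2 T,
    Tendsto (fun h : ℝ => h⁻¹ • (S h f - f)) (𝓝[>] 0) (𝓝 g) ↔ IsFP f (-g)

end FokkerPlanck

end

/-!
The Fokker-Planck equation with `V = 0` is solved by averaging over the Kolmogorov process
`dX = -V dt`, `dV = -V dt + √2 dW`. At a fixed time this process is an affine function `flow` of the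
starting point and of two independent standard Gaussian variables, so that
`f(t)(x, v) = 𝔼 f₀(flow t (x, v))`. The flow preserves the Maxwellian
(`measurePreserving_flow`), hence `f ↦ f ∘ flow` is an isometry into the `L²` space over phase space
and noise. The average over the noise is the adjoint of a tensor product `f ↦ f ⊗ w` with a weight
`w` in the noise, and this makes weighted averages bounded by the `L²` norm of the weight
(`norm_flowAverage_le`).

By Gaussian integration by parts, the derivatives `∂ₓ` and `∂ᵥ` of the average are averages of the
same kind, whose weights are linear in the noise (`isWeakDx_flowAverage`, `isWeakDv_flowAverage`).
The weight for `∂ₓ` has norm `1 / posStd t`, where `posStd t ^ 2 = 2 (t - 2 tanh (t / 2)) ≥ t³ / 24`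
is the variance of the position given the final velocity. This is the rate `t^(-3/2)`. The weight for
`∂ᵥ` has squared norm at most `2 / t + t² / posStd t ^ 2 = O(1 / t)`.

All identities between operators are verified on the functions `trig n ξ θ`, that is
`cos (2πn x / T + ξ v + θ)`, which the semigroup maps to multiples of one another
(`flowAverage_trigL`). Their span is dense in `L²`, since they determine finite measures
(`measure_ext_of_integral_trig`).

That the generator is exactly `-P`, with the maximal distributional domain, follows from three facts.
A function for which `-P f = g` holds weakly against trigonometric functions is in the domain of the
generator (`tendsto_diffQuot_fpSemigroup`); the weak equation extends from test functions to
trigonometric functions by truncation in `v` (`IsFP.integral_mul_genTrig`); and the adjoint semigroup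
is of the same form with reversed transport (`inner_fpSemigroup_left`), so that test functions are in
the domain of its generator. Finally, any semigroup with this generator is the one constructed here,
because the generator is dissipative (`IsFPSemigroup.eq_fpSemigroup`).
-/

noncomputable section

namespace FokkerPlanck

section Trigonometric

variable {T : ℝ}

/-! ### Trigonometric functions on phase space -/

/-- The angular frequency `2πn / T` of the `n`-th Fourier mode on `ℝ / Tℤ`. -/
def freq (T : ℝ) (n : ℤ) : ℝ := 2 * Real.pi * n / T

lemma freq_neg (n : ℤ) : freq T (-n) = - freq T n := by
  simp only [freq]; push_cast; ring

/-- The function `(x, v) ↦ cos (2πn x / T + ξ v + θ)` on `𝕋 × ℝ`, for an integer mode `n`, a real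
velocity frequency `ξ` and a phase `θ`. The phase makes the family closed under differentiation
(up to scalars and factors `v`) without using complex values. -/
def trig (n : ℤ) (ξ θ : ℝ) (p : AddCircle T × ℝ) : ℝ :=
  (fourier n p.1 * Complex.exp ((ξ * p.2 + θ : ℝ) * Complex.I)).re

lemma trig_coe (n : ℤ) (ξ θ x v : ℝ) :
    trig n ξ θ ((x : AddCircle T), v) = Real.cos (freq T n * x + ξ * v + θ) := by
  have h : (fourier n (x : AddCircle T) : ℂ) * Complex.exp ((ξ * v + θ : ℝ) * Complex.I)
      = Complex.exp ((freq T n * x + ξ * v + θ : ℝ) * Complex.I) := by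
    rw [fourier_coe_apply, ← Complex.exp_add]
    congr 1
    simp only [freq]
    push_cast
    ring
  simp only [trig, h, Complex.exp_ofReal_mul_I_re]

lemma exists_coe_eq (p : AddCircle T × ℝ) : ∃ x v : ℝ, p = ((x : AddCircle T), v) := by
  obtain ⟨x, hx⟩ := QuotientAddGroup.mk_surjective p.1
  exact ⟨x, p.2, Prod.ext hx.symm rfl⟩

lemma abs_trig_le_one (n : ℤ) (ξ θ : ℝ) (p : AddCircle T × ℝ) : |trig n ξ θ p| ≤ 1 := by
  obtain ⟨x, v, rfl⟩ := exists_coe_eq p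
  rw [trig_coe]
  exact Real.abs_cos_le_one _

lemma continuous_trig (n : ℤ) (ξ θ : ℝ) : Continuous (trig n ξ θ : AddCircle T × ℝ → ℝ) := by
  unfold trig
  fun_prop

lemma trig_add_pi (n : ℤ) (ξ θ : ℝ) (p : AddCircle T × ℝ) :
    trig n ξ (θ + Real.pi / 2 + Real.pi / 2) p = - trig n ξ θ p := by
  obtain ⟨x, v, rfl⟩ := exists_coe_eq p
  rw [trig_coe, trig_coe, ← Real.cos_add_pi]
  congr 1
  ring

lemma hasDerivAt_trig_freq (n : ℤ) (ξ θ : ℝ) (p : AddCircle T × ℝ) :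
    HasDerivAt (fun ζ => trig n ζ θ p) (p.2 * trig n ξ (θ + Real.pi / 2) p) ξ := by
  obtain ⟨x, v, rfl⟩ := exists_coe_eq p
  simp only [trig_coe]
  have := ((((hasDerivAt_id ξ).mul_const v).const_add (freq T n * x)).add_const θ).cos
  refine this.congr_deriv ?_
  rw [← add_assoc, Real.cos_add_pi_div_two]
  simp
  ring

lemma hasDerivAt_trig_velocity (n : ℤ) (ξ θ : ℝ) (x : AddCircle T) (v : ℝ) :
    HasDerivAt (fun w => trig n ξ θ (x, w)) (ξ * trig n ξ (θ + Real.pi / 2) (x, v)) v := by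
  obtain ⟨x, rfl⟩ := QuotientAddGroup.mk_surjective x
  simp only [trig_coe]
  have := ((((hasDerivAt_id v).const_mul ξ).const_add (freq T n * x)).add_const θ).cos
  refine this.congr_deriv ?_
  rw [← add_assoc, Real.cos_add_pi_div_two]
  simp
  ring

lemma hasDerivAt_trig_position (n : ℤ) (ξ θ x v : ℝ) :
    HasDerivAt (fun s : ℝ => trig n ξ θ ((s : AddCircle T), v))
      (freq T n * trig n ξ (θ + Real.pi / 2) ((x : AddCircle T), v)) x := by
  simp only [trig_coe]
  have := ((((hasDerivAt_id x).const_mul (freq T n)).add_const (ξ * v)).add_const θ).cos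
  refine this.congr_deriv ?_
  rw [← add_assoc, Real.cos_add_pi_div_two]
  simp
  ring

lemma trig_mul_trig (n n' : ℤ) (ξ ξ' θ θ' : ℝ) (p : AddCircle T × ℝ) :
    trig n ξ θ p * trig n' ξ' θ' p =
      (1 / 2) * (trig (n - n') (ξ - ξ') (θ - θ') p + trig (n + n') (ξ + ξ') (θ + θ') p) := by
  obtain ⟨x, v, rfl⟩ := exists_coe_eq p
  simp only [trig_coe]
  have h1 : freq T (n - n') * x + (ξ - ξ') * v + (θ - θ') =
      (freq T n * x + ξ * v + θ) - (freq T n' * x + ξ' * v + θ') := by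
    simp only [freq]; push_cast; ring
  have h2 : freq T (n + n') * x + (ξ + ξ') * v + (θ + θ') =
      (freq T n * x + ξ * v + θ) + (freq T n' * x + ξ' * v + θ') := by
    simp only [freq]; push_cast; ring
  rw [h1, h2]
  generalize freq T n * x + ξ * v + θ = a
  generalize freq T n' * x + ξ' * v + θ' = b
  rw [Real.cos_sub, Real.cos_add]
  ring

/-- `trig` as a bounded continuous function. -/
def trigBCF (T : ℝ) (n : ℤ) (ξ θ : ℝ) : BoundedContinuousFunction (AddCircle T × ℝ) ℝ :=
  BoundedContinuousFunction.ofNormedAddCommGroup (trig n ξ θ) (continuous_trig n ξ θ) 1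
    (fun p => abs_trig_le_one n ξ θ p)

/-- The algebra of trigonometric polynomials on `𝕋 × ℝ`. -/
def trigAlgebra (T : ℝ) : StarSubalgebra ℝ (BoundedContinuousFunction (AddCircle T × ℝ) ℝ) where
  toSubalgebra := (Submodule.span ℝ (Set.range fun i : ℤ × ℝ × ℝ =>
      trigBCF T i.1 i.2.1 i.2.2)).toSubalgebra
    (Submodule.subset_span ⟨(0, 0, 0), by
      ext p
      obtain ⟨x, v, rfl⟩ := exists_coe_eq p
      change trig 0 0 0 _ = 1
      rw [trig_coe]
      simp [freq]⟩)
    (by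
      intro f g hf hg
      induction hf, hg using Submodule.span_induction₂ with
      | mem_mem f g hf hg =>
        obtain ⟨⟨n, ξ, θ⟩, rfl⟩ := hf
        obtain ⟨⟨n', ξ', θ'⟩, rfl⟩ := hg
        have h : trigBCF T n ξ θ * trigBCF T n' ξ' θ' =
            (1 / 2 : ℝ) • (trigBCF T (n - n') (ξ - ξ') (θ - θ')
              + trigBCF T (n + n') (ξ + ξ') (θ + θ')) := by
          ext p
          exact trig_mul_trig n n' ξ ξ' θ θ' p
        simp only
        rw [h]
        exact Submodule.smul_mem _ _ (Submodule.add_mem _ (Submodule.subset_span ⟨(_, _, _), rfl⟩)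
          (Submodule.subset_span ⟨(_, _, _), rfl⟩))
      | zero_left g hg => simp
      | zero_right f hf => simp
      | add_left f g h _ _ _ h1 h2 => rw [add_mul]; exact Submodule.add_mem _ h1 h2
      | add_right f g h _ _ _ h1 h2 => rw [mul_add]; exact Submodule.add_mem _ h1 h2
      | smul_left c f g _ _ h => rw [smul_mul_assoc]; exact Submodule.smul_mem _ _ h
      | smul_right c f g _ _ h => rw [mul_smul_comm]; exact Submodule.smul_mem _ _ h)
  star_mem' := by
    intro f hf
    have : star f = f := by ext p; simp
    rwa [this]

lemma exists_trig_ne [hT : Fact (0 < T)] {p p' : AddCircle T × ℝ} (h : p ≠ p') :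
    ∃ n ξ θ, trig n ξ θ p ≠ trig n ξ θ p' := by
  have hT0 : T ≠ 0 := hT.out.ne'
  obtain ⟨x, v, rfl⟩ := exists_coe_eq p
  obtain ⟨x', v', rfl⟩ := exists_coe_eq p'
  by_cases hv : v = v'
  · subst hv
    refine ⟨1, 0, - (freq T 1 * x'), ?_⟩
    rw [trig_coe, trig_coe]
    intro hc
    apply h
    rw [show freq T 1 * x' + 0 * v + -(freq T 1 * x') = 0 by ring, Real.cos_zero,
      Real.cos_eq_one_iff] at hc
    obtain ⟨m, hm⟩ := hc
    have hm' : x - x' = m * T := by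
      simp only [freq] at hm
      have := Real.pi_ne_zero
      push_cast at hm
      have h2 : 2 * Real.pi * (m * T - (x - x')) = 0 := by
        field_simp at hm
        linear_combination hm
      rcases mul_eq_zero.1 h2 with h3 | h3
      · exact absurd h3 (by positivity)
      · linarith
    refine Prod.ext ?_ rfl
    change (x : AddCircle T) = x'
    rw [← sub_eq_zero, ← AddCircle.coe_sub, AddCircle.coe_eq_zero_iff]
    exact ⟨m, by rw [hm', zsmul_eq_mul]⟩
  · refine ⟨0, Real.pi / (v - v'), - (Real.pi / (v - v') * v'), ?_⟩
    rw [trig_coe, trig_coe]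
    have hv' : v - v' ≠ 0 := sub_ne_zero.2 hv
    have h1 : freq T 0 * x + Real.pi / (v - v') * v + -(Real.pi / (v - v') * v') = Real.pi := by
      simp only [freq]; field_simp; push_cast; ring
    have h2 : freq T 0 * x' + Real.pi / (v - v') * v' + -(Real.pi / (v - v') * v') = 0 := by
      simp only [freq]; push_cast; ring
    rw [h1, h2, Real.cos_pi, Real.cos_zero]
    norm_num

/-- A finite measure on `𝕋 × ℝ` is determined by its integrals of trigonometric functions. -/
lemma measure_ext_of_integral_trig [hT : Fact (0 < T)] {μ₁ μ₂ : Measure (AddCircle T × ℝ)}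
    [IsFiniteMeasure μ₁] [IsFiniteMeasure μ₂]
    (h : ∀ n ξ θ, ∫ p, trig n ξ θ p ∂μ₁ = ∫ p, trig n ξ θ p ∂μ₂) : μ₁ = μ₂ := by
  refine ext_of_forall_mem_subalgebra_integral_eq_of_pseudoEMetric_complete_countable
    (A := trigAlgebra T) ?_ ?_
  · intro p p' hp
    obtain ⟨n, ξ, θ, hne⟩ := exists_trig_ne hp
    refine ⟨trig n ξ θ, ⟨_, ⟨trigBCF T n ξ θ, Submodule.subset_span ⟨(n, ξ, θ), rfl⟩, rfl⟩, rfl⟩,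
      hne⟩
  · intro g hg
    change g ∈ Submodule.span ℝ _ at hg
    induction hg using Submodule.span_induction with
    | mem g hg =>
      obtain ⟨⟨n, ξ, θ⟩, rfl⟩ := hg
      exact h n ξ θ
    | zero => simp
    | add f g _ _ hf hg =>
      simp only [BoundedContinuousFunction.coe_add, Pi.add_apply]
      rw [integral_add (f.integrable _) (g.integrable _), hf, hg,
        integral_add (f.integrable _) (g.integrable _)]
    | smul c f _ hf =>
      simp only [BoundedContinuousFunction.coe_smul]
      rw [integral_smul, integral_smul, hf]

end Trigonometric

section Density

variable {T : ℝ} [Fact (0 < T)]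

/-! ### Density of trigonometric functions -/

instance : IsProbabilityMeasure (maxwellian T) := by
  unfold maxwellian
  infer_instance

lemma inner_eq_integral (f g : L2 T) : inner ℝ f g = ∫ p, f p * g p ∂(maxwellian T) := by
  rw [L2.inner_def]
  refine integral_congr_ae (Eventually.of_forall fun p => ?_)
  simp [mul_comm]

lemma inner_toLp (f : L2 T) {φ : AddCircle T × ℝ → ℝ} (hφ : MemLp φ 2 (maxwellian T)) :
    inner ℝ f (hφ.toLp φ) = ∫ p, f p * φ p ∂(maxwellian T) := by
  rw [inner_eq_integral]
  refine integral_congr_ae ?_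
  filter_upwards [hφ.coeFn_toLp] with p hp
  rw [hp]

lemma integrable_L2_mul (f : L2 T) {φ : AddCircle T × ℝ → ℝ} (hφ : MemLp φ 2 (maxwellian T)) :
    Integrable (fun p => f p * φ p) (maxwellian T) :=
  (Lp.memLp f).integrable_mul hφ

lemma memLp_trig (n : ℤ) (ξ θ : ℝ) (q : ENNReal) :
    MemLp (trig n ξ θ : AddCircle T × ℝ → ℝ) q (maxwellian T) :=
  MemLp.of_bound (continuous_trig n ξ θ).aestronglyMeasurable 1
    (Eventually.of_forall fun p => abs_trig_le_one n ξ θ p)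

/-- The class of `trig n ξ θ` in `L²`. -/
def trigL (T : ℝ) [Fact (0 < T)] (n : ℤ) (ξ θ : ℝ) : L2 T := (memLp_trig n ξ θ 2).toLp _

lemma inner_trigL (f : L2 T) (n : ℤ) (ξ θ : ℝ) :
    inner ℝ f (trigL T n ξ θ) = ∫ p, f p * trig n ξ θ p ∂(maxwellian T) :=
  inner_toLp f _

/-- An `L²` function orthogonal to all trigonometric functions vanishes: the finite measures with
densities `f⁺` and `f⁻` have the same trigonometric integrals. -/
lemma eq_zero_of_integral_trig (f : L2 T)
    (h : ∀ n ξ θ, ∫ p, f p * trig n ξ θ p ∂(maxwellian T) = 0) : f = 0 := by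
  have hfi : Integrable f (maxwellian T) := (Lp.memLp f).integrable (by norm_num)
  have hm : Measurable (f : AddCircle T × ℝ → ℝ) := (Lp.stronglyMeasurable f).measurable
  have hint : ∀ g : AddCircle T × ℝ → ℝ, Integrable g (maxwellian T) → Measurable g →
      ∀ n ξ θ, ∫ p, trig n ξ θ p ∂((maxwellian T).withDensity fun p => ENNReal.ofReal (g p)) =
        ∫ p, max (g p) 0 * trig n ξ θ p ∂(maxwellian T) := by
    intro g _ hgm n ξ θ
    rw [integral_withDensity_eq_integral_toReal_smul hgm.ennreal_ofReal
      (Eventually.of_forall fun p => ENNReal.ofReal_lt_top)]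
    refine integral_congr_ae (Eventually.of_forall fun p => ?_)
    simp [ENNReal.toReal_ofReal']
  have hbd : ∀ g : AddCircle T × ℝ → ℝ, Integrable g (maxwellian T) → ∀ n ξ θ,
      Integrable (fun p => max (g p) 0 * trig n ξ θ p) (maxwellian T) := by
    intro g hg n ξ θ
    exact hg.pos_part.mul_bdd (c := 1) (continuous_trig n ξ θ).aestronglyMeasurable
      (Eventually.of_forall fun p => abs_trig_le_one n ξ θ p)
  have := isFiniteMeasure_withDensity_ofReal hfi.2
  have := isFiniteMeasure_withDensity_ofReal hfi.neg.2
  have heq : (maxwellian T).withDensity (fun p => ENNReal.ofReal (f p)) =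
      (maxwellian T).withDensity (fun p => ENNReal.ofReal ((-f : AddCircle T × ℝ → ℝ) p)) := by
    refine measure_ext_of_integral_trig fun n ξ θ => ?_
    rw [hint _ hfi hm, hint _ hfi.neg hm.neg, ← sub_eq_zero,
      ← integral_sub (hbd _ hfi n ξ θ) (hbd _ hfi.neg n ξ θ)]
    refine Eq.trans ?_ (h n ξ θ)
    refine integral_congr_ae (Eventually.of_forall fun p => ?_)
    have : max (f p) 0 - max (-f p) 0 = f p := by
      rcases le_total 0 (f p) with h0 | h0
      · rw [max_eq_left h0, max_eq_right (by linarith)]; ring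
      · rw [max_eq_right h0, max_eq_left (by linarith)]; ring
    simp only [Pi.neg_apply]
    rw [← sub_mul, this]
  have hae := (withDensity_eq_iff hm.ennreal_ofReal.aemeasurable
    hm.neg.ennreal_ofReal.aemeasurable (by
      have := measure_ne_top ((maxwellian T).withDensity fun p => ENNReal.ofReal (f p)) Set.univ
      rwa [withDensity_apply _ MeasurableSet.univ, setLIntegral_univ] at this)).1 heq
  refine Lp.ext ?_
  filter_upwards [hae, Lp.coeFn_zero ℝ 2 (maxwellian T)] with p hp h0
  rw [h0]
  simp only [Pi.neg_apply] at hp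
  rcases lt_trichotomy (f p) 0 with hlt | h0 | hlt
  · rw [ENNReal.ofReal_of_nonpos hlt.le, eq_comm, ENNReal.ofReal_eq_zero] at hp
    linarith
  · exact h0
  · rw [ENNReal.ofReal_of_nonpos (neg_nonpos.2 hlt.le), ENNReal.ofReal_eq_zero] at hp
    linarith

lemma ext_integral_trig {f g : L2 T} (h : ∀ n ξ θ, ∫ p, f p * trig n ξ θ p ∂(maxwellian T) =
    ∫ p, g p * trig n ξ θ p ∂(maxwellian T)) : f = g := by
  rw [← sub_eq_zero]
  refine eq_zero_of_integral_trig _ fun n ξ θ => ?_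
  rw [← inner_trigL, inner_sub_left, inner_trigL, inner_trigL, h, sub_self]

/-- The trigonometric polynomials, as a subspace of `L²`. -/
def trigSpan (T : ℝ) [Fact (0 < T)] : Submodule ℝ (L2 T) :=
  Submodule.span ℝ (Set.range fun i : ℤ × ℝ × ℝ => trigL T i.1 i.2.1 i.2.2)

lemma trigL_mem_trigSpan (n : ℤ) (ξ θ : ℝ) : trigL T n ξ θ ∈ trigSpan T :=
  Submodule.subset_span ⟨(n, ξ, θ), rfl⟩

lemma dense_trigSpan : Dense (trigSpan T : Set (L2 T)) := by
  rw [Submodule.dense_iff_topologicalClosure_eq_top, Submodule.topologicalClosure_eq_top_iff,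
    Submodule.eq_bot_iff]
  intro f hf
  refine eq_zero_of_integral_trig f fun n ξ θ => ?_
  rw [← inner_trigL]
  exact (Submodule.mem_orthogonal' _ _).1 hf _ (trigL_mem_trigSpan n ξ θ)

/-- Continuous linear maps on `L²` which agree on trigonometric functions are equal. -/
lemma clm_ext_trig {E : Type*} [NormedAddCommGroup E] [NormedSpace ℝ E] {A B : L2 T →L[ℝ] E}
    (h : ∀ n ξ θ, A (trigL T n ξ θ) = B (trigL T n ξ θ)) : A = B := by
  refine ContinuousLinearMap.ext_on (s := Set.range fun i : ℤ × ℝ × ℝ => trigL T i.1 i.2.1 i.2.2)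
    dense_trigSpan ?_
  rintro _ ⟨⟨n, ξ, θ⟩, rfl⟩
  exact h n ξ θ

/-- The norm of `f` may be computed by testing against trigonometric polynomials. -/
lemma norm_le_of_forall_trigSpan (f : L2 T) (M : ℝ)
    (h : ∀ e ∈ trigSpan T, inner ℝ f e ≤ M * ‖e‖) : ‖f‖ ≤ M := by
  have h' : ∀ e : L2 T, inner ℝ f e ≤ M * ‖e‖ := fun e =>
    dense_trigSpan.induction (P := fun e => inner ℝ f e ≤ M * ‖e‖) (fun e he => h e he)
      (isClosed_le (by fun_prop) (by fun_prop)) e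
  have h1 := h' f
  rw [real_inner_self_eq_norm_sq, sq] at h1
  rcases (norm_nonneg f).eq_or_lt with h0 | h0
  · obtain ⟨e, -, he⟩ : ∃ e ∈ trigSpan T, 0 < ‖e‖ := by
      refine ⟨trigL T 0 0 0, trigL_mem_trigSpan _ _ _, norm_pos_iff.2 fun hz => ?_⟩
      have h2 : inner ℝ (trigL T 0 0 0) (trigL T 0 0 0) = (1 : ℝ) := by
        rw [inner_trigL]
        have : ∀ᵐ p ∂(maxwellian T), trigL T 0 0 0 p * trig 0 0 0 p = 1 := by
          filter_upwards [(memLp_trig (T := T) 0 0 0 2).coeFn_toLp] with p hp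
          rw [trigL, hp]
          obtain ⟨x, v, rfl⟩ := exists_coe_eq p
          rw [trig_coe]
          simp [freq]
        rw [integral_congr_ae this]
        simp
      rw [hz, inner_zero_left] at h2
      exact zero_ne_one h2
    have h3 := h' e
    rw [norm_eq_zero.1 h0.symm, inner_zero_left] at h3
    rw [← h0]
    exact nonneg_of_mul_nonneg_left h3 he
  · exact le_of_mul_le_mul_right h1 h0

/-! ### Gaussian integrals -/

/-- The standard Gaussian measure on `ℝ`. -/
abbrev stdGauss : Measure ℝ := ProbabilityTheory.gaussianReal 0 1

lemma memLp_id_stdGauss : MemLp (fun a : ℝ => a) 2 stdGauss :=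
  ProbabilityTheory.memLp_id_gaussianReal 2

lemma integrable_id_stdGauss : Integrable (fun a : ℝ => a) stdGauss :=
  memLp_id_stdGauss.integrable (by norm_num)

lemma integral_id_stdGauss : ∫ a, a ∂stdGauss = 0 :=
  ProbabilityTheory.integral_id_gaussianReal

lemma integral_sq_stdGauss : ∫ a, a ^ 2 ∂stdGauss = 1 := by
  have h := ProbabilityTheory.variance_id_gaussianReal (μ := 0) (v := 1)
  rw [ProbabilityTheory.variance_of_integral_eq_zero (by fun_prop)
    (by simp)] at h
  simpa using h

/-- Gaussian integration by parts. -/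
lemma integral_deriv_stdGauss {ψ ψ' : ℝ → ℝ} (hd : ∀ a, HasDerivAt ψ (ψ' a) a)
    (h0 : Integrable ψ stdGauss) (h1 : Integrable ψ' stdGauss)
    (h2 : Integrable (fun a => a * ψ a) stdGauss) :
    ∫ a, ψ' a ∂stdGauss = ∫ a, a * ψ a ∂stdGauss := by
  set g := ProbabilityTheory.gaussianPDFReal 0 1 with hg
  have hiff : ∀ f : ℝ → ℝ, Integrable f stdGauss → Integrable (fun a => g a * f a) := by
    intro f hf
    rw [stdGauss, ProbabilityTheory.gaussianReal_of_var_ne_zero _ one_ne_zero,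
      integrable_withDensity_iff_integrable_smul' (by fun_prop)
        (Eventually.of_forall fun a => ProbabilityTheory.gaussianPDF_lt_top)] at hf
    refine hf.congr (Eventually.of_forall fun a => ?_)
    simp [hg, ProbabilityTheory.toReal_gaussianPDF]
  have hgd : ∀ a, HasDerivAt g (-a * g a) a := by
    intro a
    have h3 : HasDerivAt (fun x : ℝ => (Real.sqrt (2 * Real.pi))⁻¹ * Real.exp (-x ^ 2 / 2))
        ((Real.sqrt (2 * Real.pi))⁻¹ * (Real.exp (-a ^ 2 / 2) * (-(2 * a) / 2))) a := by
      have := (((hasDerivAt_pow 2 a).neg.div_const 2).exp).const_mul (Real.sqrt (2 * Real.pi))⁻¹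
      simpa using this
    have h4 : g = fun x : ℝ => (Real.sqrt (2 * Real.pi))⁻¹ * Real.exp (-x ^ 2 / 2) := by
      ext x
      simp [hg, ProbabilityTheory.gaussianPDFReal]
    rw [h4]
    convert h3 using 1
    ring
  have hz := integral_eq_zero_of_hasDerivAt_of_integrable
    (f := fun a => g a * ψ a) (f' := fun a => g a * (ψ' a - a * ψ a))
    (fun a => by
      have := (hgd a).mul (hd a)
      rw [show g a * (ψ' a - a * ψ a) = -a * g a * ψ a + g a * ψ' a by ring]
      exact this)
    (hiff _ (h1.sub h2)) (hiff _ h0)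
  have h5 : ∫ a, (ψ' a - a * ψ a) ∂stdGauss = 0 := by
    rw [stdGauss, ProbabilityTheory.integral_gaussianReal_eq_integral_smul one_ne_zero]
    simpa [hg] using hz
  rw [integral_sub h1 h2] at h5
  linarith

lemma integrable_cos_stdGauss (α β : ℝ) :
    Integrable (fun a => Real.cos (α + β * a)) stdGauss :=
  Integrable.of_bound (by fun_prop) 1 (Eventually.of_forall fun a => Real.abs_cos_le_one _)

lemma integrable_sin_stdGauss (α β : ℝ) :
    Integrable (fun a => Real.sin (α + β * a)) stdGauss :=
  Integrable.of_bound (by fun_prop) 1 (Eventually.of_forall fun a => Real.abs_sin_le_one _)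

lemma integrable_mul_cos_stdGauss (α β : ℝ) :
    Integrable (fun a => a * Real.cos (α + β * a)) stdGauss :=
  integrable_id_stdGauss.mul_bdd (c := 1) (by fun_prop)
    (Eventually.of_forall fun a => Real.abs_cos_le_one _)

lemma integral_cos_stdGauss (α β : ℝ) :
    ∫ a, Real.cos (α + β * a) ∂stdGauss = Real.exp (-β ^ 2 / 2) * Real.cos α := by
  have h := ProbabilityTheory.charFun_gaussianReal (μ := 0) (v := 1) β
  rw [charFun_apply_real] at h
  have hi : Integrable (fun a : ℝ => Complex.exp (α * Complex.I) * Complex.exp (β * a * Complex.I))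
      stdGauss := by
    refine Integrable.of_bound (by fun_prop) 1 (Eventually.of_forall fun a => ?_)
    rw [← Complex.exp_add, ← add_mul]
    have : ((α : ℂ) + β * a) = ((α + β * a : ℝ) : ℂ) := by push_cast; ring
    rw [this, Complex.norm_exp_ofReal_mul_I]
  have h2 : ∫ a : ℝ, (Complex.exp (α * Complex.I) * Complex.exp (β * a * Complex.I)) ∂stdGauss =
      Complex.exp (α * Complex.I) * ((Real.exp (-β ^ 2 / 2) : ℝ) : ℂ) := by
    rw [integral_const_mul, h]
    congr 1
    rw [Complex.ofReal_exp]
    congr 1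
    push_cast
    ring
  have h3 := congrArg Complex.re h2
  rw [← RCLike.re_eq_complex_re, ← integral_re hi] at h3
  rw [show (fun a : ℝ => Real.cos (α + β * a)) = fun a : ℝ =>
    RCLike.re (Complex.exp (α * Complex.I) * Complex.exp (β * a * Complex.I)) from ?_, h3]
  · simp only [RCLike.re_eq_complex_re]
    rw [mul_comm, Complex.re_ofReal_mul, Complex.exp_ofReal_mul_I_re]
  · ext a
    rw [← Complex.exp_add, ← add_mul]
    have : ((α : ℂ) + β * a) = ((α + β * a : ℝ) : ℂ) := by push_cast; ring
    rw [this, RCLike.re_eq_complex_re, Complex.exp_ofReal_mul_I_re]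

lemma integral_sin_stdGauss (α β : ℝ) :
    ∫ a, Real.sin (α + β * a) ∂stdGauss = Real.exp (-β ^ 2 / 2) * Real.sin α := by
  have h := integral_cos_stdGauss (α - Real.pi / 2) β
  rw [Real.cos_sub_pi_div_two] at h
  rw [← h]
  refine integral_congr_ae (Eventually.of_forall fun a => ?_)
  simp only
  rw [← Real.cos_sub_pi_div_two]
  congr 1
  ring

lemma integral_mul_cos_stdGauss (α β : ℝ) :
    ∫ a, a * Real.cos (α + β * a) ∂stdGauss = -β * (Real.exp (-β ^ 2 / 2) * Real.sin α) := by
  rw [← integral_sin_stdGauss, ← integral_const_mul]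
  refine (integral_deriv_stdGauss (ψ := fun a => Real.cos (α + β * a)) (fun a => ?_)
    (integrable_cos_stdGauss α β) ((integrable_sin_stdGauss α β).const_mul _)
    (integrable_mul_cos_stdGauss α β)).symm
  have := (((hasDerivAt_id a).const_mul β).const_add α).cos
  simpa [mul_comm] using this

/-- The law of the two independent standard Gaussian variables which drive the flow. -/
def noise : Measure (ℝ × ℝ) := stdGauss.prod stdGauss

instance : IsProbabilityMeasure noise := by
  unfold noise
  infer_instance

/-- The affine function with coefficients `w` on the noise space. -/
def affineWeight (w : ℝ × ℝ × ℝ) (y : ℝ × ℝ) : ℝ := w.1 + w.2.1 * y.1 + w.2.2 * y.2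

lemma memLp_affineWeight (w : ℝ × ℝ × ℝ) : MemLp (affineWeight w) 2 noise := by
  have h1 : MemLp (fun y : ℝ × ℝ => y.1) 2 noise :=
    memLp_id_stdGauss.comp_measurePreserving measurePreserving_fst
  have h2 : MemLp (fun y : ℝ × ℝ => y.2) 2 noise :=
    memLp_id_stdGauss.comp_measurePreserving measurePreserving_snd
  exact ((memLp_const w.1).add (h1.const_mul w.2.1)).add (h2.const_mul w.2.2)

lemma integral_affineWeight_sq (w : ℝ × ℝ × ℝ) :
    ∫ y, affineWeight w y ^ 2 ∂noise = w.1 ^ 2 + w.2.1 ^ 2 + w.2.2 ^ 2 := by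
  have hsq : Integrable (fun a : ℝ => a ^ 2) stdGauss := memLp_id_stdGauss.integrable_sq
  have hin : ∀ c e : ℝ, ∫ b, (c + e * b) ^ 2 ∂stdGauss = c ^ 2 + e ^ 2 := by
    intro c e
    have : ∀ b : ℝ, (c + e * b) ^ 2 = (c ^ 2 + (2 * c * e) * b) + e ^ 2 * b ^ 2 := fun b => by ring
    simp only [this]
    rw [integral_add ((integrable_const _).fun_add (integrable_id_stdGauss.const_mul _))
      (hsq.const_mul _), integral_add (integrable_const _) (integrable_id_stdGauss.const_mul _),
      integral_const_mul, integral_const_mul, integral_sq_stdGauss, integral_id_stdGauss]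
    simp
  have hi := (memLp_affineWeight w).integrable_sq
  rw [noise] at hi ⊢
  rw [integral_prod _ hi]
  simp only [affineWeight, hin]
  have hi2 : Integrable (fun a : ℝ => (w.1 + w.2.1 * a) ^ 2) stdGauss :=
    ((memLp_const w.1).add (memLp_id_stdGauss.const_mul w.2.1)).integrable_sq
  rw [integral_add hi2 (integrable_const _), hin]
  simp

/-- Integrating a cosine against an affine weight: the Gaussian average damps the amplitude, and
the linear part of the weight acts as a derivative in the phase. -/
lemma integral_cos_mul_affineWeight (α β δ : ℝ) (w : ℝ × ℝ × ℝ) :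
    ∫ y, Real.cos (α + β * y.1 + δ * y.2) * affineWeight w y ∂noise =
      Real.exp (-(β ^ 2 + δ ^ 2) / 2) *
        (w.1 * Real.cos α - (w.2.1 * β + w.2.2 * δ) * Real.sin α) := by
  have hi : Integrable (fun y : ℝ × ℝ => Real.cos (α + β * y.1 + δ * y.2) * affineWeight w y)
      noise :=
    ((memLp_affineWeight w).integrable (by norm_num)).bdd_mul (c := 1) (by fun_prop)
      (Eventually.of_forall fun y => Real.abs_cos_le_one _)
  have hin : ∀ a : ℝ, ∫ b, Real.cos (α + β * a + δ * b) * affineWeight w (a, b) ∂stdGauss =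
      Real.exp (-δ ^ 2 / 2) * (w.1 * Real.cos (α + β * a) + w.2.1 * (a * Real.cos (α + β * a))
        - w.2.2 * δ * Real.sin (α + β * a)) := by
    intro a
    have : ∀ b : ℝ, Real.cos (α + β * a + δ * b) * affineWeight w (a, b) =
        (w.1 + w.2.1 * a) * Real.cos (α + β * a + δ * b) +
          w.2.2 * (b * Real.cos (α + β * a + δ * b)) := fun b => by
      simp only [affineWeight]; ring
    simp only [this]
    rw [integral_add ((integrable_cos_stdGauss _ _).const_mul _)
      ((integrable_mul_cos_stdGauss _ _).const_mul _), integral_const_mul, integral_const_mul,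
      integral_cos_stdGauss, integral_mul_cos_stdGauss]
    ring
  rw [noise] at hi ⊢
  rw [integral_prod _ hi]
  simp only [hin]
  rw [integral_const_mul, integral_sub (((integrable_cos_stdGauss _ _).const_mul _).fun_add
    ((integrable_mul_cos_stdGauss _ _).const_mul _)) ((integrable_sin_stdGauss _ _).const_mul _),
    integral_add ((integrable_cos_stdGauss _ _).const_mul _)
    ((integrable_mul_cos_stdGauss _ _).const_mul _), integral_const_mul, integral_const_mul,
    integral_const_mul, integral_cos_stdGauss, integral_mul_cos_stdGauss, integral_sin_stdGauss,
    show -(β ^ 2 + δ ^ 2) / 2 = -δ ^ 2 / 2 + -β ^ 2 / 2 by ring, Real.exp_add]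
  ring

end Density

section Flow

variable {T : ℝ}

/-! ### The Kolmogorov flow -/

/-- The standard deviation of the velocity at time `t` of the Ornstein-Uhlenbeck process. -/
def velStd (t : ℝ) : ℝ := Real.sqrt (1 - Real.exp (-t) ^ 2)

/-- The coefficient with which the velocity noise enters the position at time `t`. -/
def crossCoeff (t : ℝ) : ℝ := -(1 - Real.exp (-t)) ^ 2 / velStd t

/-- The conditional standard deviation of the position at time `t`, given the velocity at time `t`.
Its square `2 (t - 2 tanh (t / 2))` is of order `t³`. -/
def posStd (t : ℝ) : ℝ := Real.sqrt (2 * t - 4 * (1 - Real.exp (-t)) / (1 + Real.exp (-t)))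

/-- The solution at time `t` of `dX = -σ V dt`, `dV = -V dt + √2 dW`, as a function of the initial
point and of two independent standard Gaussian variables. For `σ = 1` averaging over the noise
solves the Fokker-Planck equation, and `σ = -1` gives the adjoint evolution. -/
def flow (σ t : ℝ) (p : (AddCircle T × ℝ) × (ℝ × ℝ)) : AddCircle T × ℝ :=
  (p.1.1 + ((σ * (posStd t * p.2.1 + crossCoeff t * p.2.2 - (1 - Real.exp (-t)) * p.1.2) : ℝ) :
    AddCircle T), Real.exp (-t) * p.1.2 + velStd t * p.2.2)

/-- The velocity frequency at time `t` of the evolution of `trig n ξ θ`, where `z = σ * freq T n`. -/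
def shiftFreq (z ξ t : ℝ) : ℝ := Real.exp (-t) * ξ - (1 - Real.exp (-t)) * z

/-- The amplitude at time `t` of the evolution of `trig n ξ θ`, where `z = σ * freq T n`. It equals
`exp (-∫₀ᵗ (shiftFreq z ξ s)² ds)`. -/
def damping (z ξ t : ℝ) : ℝ :=
  Real.exp (-(z ^ 2 * t - 2 * z * (ξ + z) * (1 - Real.exp (-t)) +
    (ξ + z) ^ 2 * (1 - Real.exp (-t) ^ 2) / 2))

lemma velStd_sq {t : ℝ} (ht : 0 ≤ t) : velStd t ^ 2 = 1 - Real.exp (-t) ^ 2 := by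
  refine Real.sq_sqrt ?_
  have h0 := Real.exp_pos (-t)
  have h1 : Real.exp (-t) ≤ 1 := Real.exp_le_one_iff.2 (by linarith)
  nlinarith

lemma velStd_pos {t : ℝ} (ht : 0 < t) : 0 < velStd t := by
  refine Real.sqrt_pos.2 ?_
  have h0 := Real.exp_pos (-t)
  have h1 : Real.exp (-t) < 1 := Real.exp_lt_one_iff.2 (by linarith)
  nlinarith

lemma hasDerivAt_exp_neg (t : ℝ) : HasDerivAt (fun s => Real.exp (-s)) (-Real.exp (-t)) t := by
  simpa using (hasDerivAt_neg t).exp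

/-- The conditional variance of the position has derivative `2 tanh² (t / 2)`, which yields its
positivity and the cubic lower bound. -/
lemma hasDerivAt_posVar (t : ℝ) : HasDerivAt
    (fun s => 2 * s - 4 * (1 - Real.exp (-s)) / (1 + Real.exp (-s)))
    (2 * ((1 - Real.exp (-t)) / (1 + Real.exp (-t))) ^ 2) t := by
  have h0 := Real.exp_pos (-t)
  have hne : 1 + Real.exp (-t) ≠ 0 := by positivity
  have h := ((hasDerivAt_id t).const_mul 2).sub
    ((((hasDerivAt_exp_neg t).const_sub 1).const_mul 4).div ((hasDerivAt_exp_neg t).const_add 1) hne)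
  refine HasDerivAt.congr_deriv (f := fun s => 2 * s - 4 * (1 - Real.exp (-s)) /
    (1 + Real.exp (-s))) h ?_
  field_simp
  ring

lemma one_sub_exp_neg_ge {t : ℝ} (h0 : 0 ≤ t) (h1 : t ≤ 1) : t / 2 ≤ 1 - Real.exp (-t) := by
  have h2 : Real.exp (-t) ≤ 1 / (1 + t) := by
    rw [Real.exp_neg, ← one_div]
    exact one_div_le_one_div_of_le (by linarith) (by linarith [Real.add_one_le_exp t])
  have h3 : 1 / (1 + t) ≤ 1 - t / 2 := by
    rw [div_le_iff₀ (by linarith)]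
    nlinarith
  linarith

lemma posVar_pos {t : ℝ} (ht : 0 < t) :
    0 < 2 * t - 4 * (1 - Real.exp (-t)) / (1 + Real.exp (-t)) := by
  have hmono : StrictMonoOn (fun s => 2 * s - 4 * (1 - Real.exp (-s)) / (1 + Real.exp (-s)))
      (Set.Ici (0 : ℝ)) := by
    refine strictMonoOn_of_deriv_pos (convex_Ici 0)
      (fun s _ => (hasDerivAt_posVar s).continuousAt.continuousWithinAt) fun s hs => ?_
    rw [interior_Ici, Set.mem_Ioi] at hs
    rw [(hasDerivAt_posVar s).deriv]
    have h1 : Real.exp (-s) < 1 := Real.exp_lt_one_iff.2 (by linarith)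
    have h0 := Real.exp_pos (-s)
    have : 0 < (1 - Real.exp (-s)) / (1 + Real.exp (-s)) := div_pos (by linarith) (by linarith)
    positivity
  have := hmono (Set.mem_Ici.2 le_rfl) (Set.mem_Ici.2 ht.le) ht
  simpa using this

lemma posStd_pos {t : ℝ} (ht : 0 < t) : 0 < posStd t := Real.sqrt_pos.2 (posVar_pos ht)

lemma posStd_sq {t : ℝ} (ht : 0 ≤ t) :
    posStd t ^ 2 = 2 * t - 4 * (1 - Real.exp (-t)) / (1 + Real.exp (-t)) := by
  refine Real.sq_sqrt ?_
  rcases ht.eq_or_lt with rfl | h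
  · simp
  · exact (posVar_pos h).le

lemma posStd_sq_ge {t : ℝ} (h0 : 0 ≤ t) (h1 : t ≤ 1) : t ^ 3 / 24 ≤ posStd t ^ 2 := by
  rw [posStd_sq h0]
  have hd : ∀ s, HasDerivAt (fun s => 2 * s - 4 * (1 - Real.exp (-s)) / (1 + Real.exp (-s)) -
      s ^ 3 / 24) (2 * ((1 - Real.exp (-s)) / (1 + Real.exp (-s))) ^ 2 - s ^ 2 / 8) s := by
    intro s
    have := (hasDerivAt_posVar s).sub ((hasDerivAt_pow 3 s).div_const 24)
    refine this.congr_deriv ?_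
    norm_num
    ring
  have hmono : MonotoneOn (fun s => 2 * s - 4 * (1 - Real.exp (-s)) / (1 + Real.exp (-s)) -
      s ^ 3 / 24) (Set.Icc (0 : ℝ) 1) := by
    refine monotoneOn_of_deriv_nonneg (convex_Icc 0 1)
      (fun s _ => (hd s).continuousAt.continuousWithinAt)
      (fun s _ => (hd s).differentiableAt.differentiableWithinAt) fun s hs => ?_
    rw [interior_Icc] at hs
    rw [(hd s).deriv]
    have h2 := one_sub_exp_neg_ge hs.1.le hs.2.le
    have h3 : Real.exp (-s) ≤ 1 := Real.exp_le_one_iff.2 (by linarith [hs.1])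
    have h4 := Real.exp_pos (-s)
    have h5 : s / 4 ≤ (1 - Real.exp (-s)) / (1 + Real.exp (-s)) := by
      rw [le_div_iff₀ (by linarith)]
      nlinarith [hs.1]
    nlinarith [hs.1]
  have := hmono (Set.mem_Icc.2 ⟨le_rfl, zero_le_one⟩) (Set.mem_Icc.2 ⟨h0, h1⟩) h0
  simp only [neg_zero, Real.exp_zero] at this
  norm_num at this
  linarith

lemma crossCoeff_mul_velStd {t : ℝ} (ht : 0 ≤ t) :
    crossCoeff t * velStd t = -(1 - Real.exp (-t)) ^ 2 := by
  rcases ht.eq_or_lt with rfl | h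
  -- at `t = 0` the division in `crossCoeff` is by zero, but the numerator vanishes as well
  · simp [velStd]
  · rw [crossCoeff, div_mul_cancel₀ _ (velStd_pos h).ne']

lemma crossCoeff_sq {t : ℝ} (ht : 0 ≤ t) :
    crossCoeff t ^ 2 = (1 - Real.exp (-t)) ^ 3 / (1 + Real.exp (-t)) := by
  have h0 := Real.exp_pos (-t)
  rcases ht.eq_or_lt with rfl | h
  · simp [velStd, crossCoeff]
  · have h1 : 1 - Real.exp (-t) ≠ 0 := by
      have : Real.exp (-t) < 1 := Real.exp_lt_one_iff.2 (by linarith)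
      linarith
    rw [crossCoeff, div_pow, velStd_sq ht,
      show 1 - Real.exp (-t) ^ 2 = (1 - Real.exp (-t)) * (1 + Real.exp (-t)) by ring]
    field_simp

/-- The covariance of the flow noise at time `t` is the one which produces `damping`. -/
lemma damping_eq {t : ℝ} (ht : 0 ≤ t) (z ξ : ℝ) :
    damping z ξ t =
      Real.exp (-((z * posStd t) ^ 2 + (z * crossCoeff t + ξ * velStd t) ^ 2) / 2) := by
  have h0 := Real.exp_pos (-t)
  have h : (z * posStd t) ^ 2 + (z * crossCoeff t + ξ * velStd t) ^ 2 =
      z ^ 2 * posStd t ^ 2 + z ^ 2 * crossCoeff t ^ 2 + 2 * z * ξ * (crossCoeff t * velStd t)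
        + ξ ^ 2 * velStd t ^ 2 := by ring
  rw [damping, h, posStd_sq ht, crossCoeff_sq ht, crossCoeff_mul_velStd ht, velStd_sq ht]
  congr 1
  field_simp
  ring

lemma continuous_flow (σ t : ℝ) : Continuous (flow (T := T) σ t) := by
  unfold flow
  have : Continuous (fun x : ℝ => (x : AddCircle T)) := AddCircle.continuous_mk' T
  fun_prop

lemma trig_flow (σ t : ℝ) (n : ℤ) (ξ θ x v : ℝ) (y : ℝ × ℝ) :
    trig n ξ θ (flow σ t (((x : AddCircle T), v), y)) =
      Real.cos ((freq T n * x + shiftFreq (σ * freq T n) ξ t * v + θ) +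
        (σ * freq T n * posStd t) * y.1 + (σ * freq T n * crossCoeff t + ξ * velStd t) * y.2) := by
  simp only [flow]
  rw [← AddCircle.coe_add, trig_coe]
  congr 1
  simp only [shiftFreq]
  ring

/-- The noise average of a trigonometric function along the flow. -/
lemma integral_trig_flow {t : ℝ} (ht : 0 ≤ t) (σ : ℝ) (w : ℝ × ℝ × ℝ) (n : ℤ) (ξ θ : ℝ)
    (p : AddCircle T × ℝ) :
    ∫ y, trig n ξ θ (flow σ t (p, y)) * affineWeight w y ∂noise =
      damping (σ * freq T n) ξ t * (w.1 * trig n (shiftFreq (σ * freq T n) ξ t) θ p +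
        (w.2.1 * (σ * freq T n * posStd t) +
          w.2.2 * (σ * freq T n * crossCoeff t + ξ * velStd t)) *
        trig n (shiftFreq (σ * freq T n) ξ t) (θ + Real.pi / 2) p) := by
  obtain ⟨x, v, rfl⟩ := exists_coe_eq p
  simp only [trig_flow]
  rw [integral_cos_mul_affineWeight, damping_eq ht, trig_coe, trig_coe, ← add_assoc,
    Real.cos_add_pi_div_two]
  ring

variable [Fact (0 < T)]

lemma integral_trig_circle {n : ℤ} (hn : n ≠ 0) (θ : ℝ) :
    ∫ x : AddCircle T, trig n 0 θ (x, 0) ∂AddCircle.haarAddCircle = 0 := by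
  refine integral_eq_zero_of_add_right_eq_neg (g := ((T / 2 / n : ℝ) : AddCircle T)) fun x => ?_
  obtain ⟨x, rfl⟩ := QuotientAddGroup.mk_surjective x
  have hT : T ≠ 0 := (Fact.out : 0 < T).ne'
  have hn' : (n : ℝ) ≠ 0 := Int.cast_ne_zero.2 hn
  change trig n 0 θ ((x : AddCircle T) + ((T / 2 / n : ℝ) : AddCircle T), 0) =
    - trig n 0 θ ((x : AddCircle T), 0)
  rw [← AddCircle.coe_add, trig_coe, trig_coe, ← Real.cos_add_pi]
  congr 1
  simp only [freq]
  field_simp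
  ring

lemma integral_trig (n : ℤ) (ξ θ : ℝ) :
    ∫ p, trig n ξ θ p ∂(maxwellian T) =
      if n = 0 then Real.exp (-ξ ^ 2 / 2) * Real.cos θ else 0 := by
  have hi := (memLp_trig (T := T) n ξ θ 1).integrable le_rfl
  rw [maxwellian] at hi ⊢
  rw [integral_prod _ hi]
  have h1 : ∀ x : AddCircle T, ∫ v, trig n ξ θ (x, v) ∂ProbabilityTheory.gaussianReal 0 1 =
      Real.exp (-ξ ^ 2 / 2) * trig n 0 θ (x, 0) := by
    intro x
    obtain ⟨x, rfl⟩ := QuotientAddGroup.mk_surjective x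
    change ∫ v, trig n ξ θ ((x : AddCircle T), v) ∂stdGauss =
      Real.exp (-ξ ^ 2 / 2) * trig n 0 θ ((x : AddCircle T), 0)
    simp only [trig_coe]
    rw [zero_mul, add_zero, ← integral_cos_stdGauss]
    refine integral_congr_ae (Eventually.of_forall fun v => ?_)
    simp only
    congr 1
    ring
  simp only [h1]
  rw [integral_const_mul]
  split_ifs with hn
  · subst hn
    have h2 : ∀ x : AddCircle T, trig 0 0 θ (x, 0) = Real.cos θ := by
      intro x
      obtain ⟨x, rfl⟩ := QuotientAddGroup.mk_surjective x
      rw [trig_coe]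
      simp [freq]
    simp [h2]
  · rw [integral_trig_circle hn, mul_zero]

/-- The flow preserves the Maxwellian: the average of a trigonometric function along the flow is a
multiple of a trigonometric function, with the same integral. -/
lemma measurePreserving_flow (σ : ℝ) {t : ℝ} (ht : 0 ≤ t) :
    MeasurePreserving (flow (T := T) σ t) ((maxwellian T).prod noise) (maxwellian T) := by
  have hm : Measurable (flow (T := T) σ t) := (continuous_flow σ t).measurable
  refine ⟨hm, ?_⟩
  have := Measure.isProbabilityMeasure_map (μ := (maxwellian T).prod noise) hm.aemeasurable
  refine measure_ext_of_integral_trig fun n ξ θ => ?_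
  rw [integral_map hm.aemeasurable (continuous_trig n ξ θ).aestronglyMeasurable]
  have hi : Integrable (fun p => trig n ξ θ (flow (T := T) σ t p)) ((maxwellian T).prod noise) :=
    Integrable.of_bound ((continuous_trig n ξ θ).comp (continuous_flow σ t)).aestronglyMeasurable 1
      (Eventually.of_forall fun p => abs_trig_le_one n ξ θ _)
  rw [integral_prod _ hi]
  have h1 : ∀ p : AddCircle T × ℝ, ∫ y, trig n ξ θ (flow σ t (p, y)) ∂noise =
      damping (σ * freq T n) ξ t * trig n (shiftFreq (σ * freq T n) ξ t) θ p := by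
    intro p
    have := integral_trig_flow ht σ (1, 0, 0) n ξ θ p
    simpa [affineWeight] using this
  simp only [h1]
  rw [integral_const_mul, integral_trig, integral_trig]
  split_ifs with hn
  · subst hn
    have hz : σ * freq T 0 = 0 := by simp [freq]
    rw [hz, damping_eq ht, shiftFreq, ← mul_assoc, ← Real.exp_add]
    congr 2
    have := velStd_sq ht
    linear_combination (-ξ ^ 2 / 2) * this
  · simp

/-! ### Noise averages as operators on `L²` -/

lemma memLp_mul_affineWeight (w : ℝ × ℝ × ℝ) (f : L2 T) :
    MemLp (fun z : (AddCircle T × ℝ) × (ℝ × ℝ) => f z.1 * affineWeight w z.2) 2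
      ((maxwellian T).prod noise) := by
  have hm : AEStronglyMeasurable
      (fun z : (AddCircle T × ℝ) × (ℝ × ℝ) => f z.1 * affineWeight w z.2)
      ((maxwellian T).prod noise) :=
    (Lp.aestronglyMeasurable f).comp_fst.mul (memLp_affineWeight w).1.comp_snd
  rw [memLp_two_iff_integrable_sq hm]
  simp only [mul_pow]
  exact (Lp.memLp f).integrable_sq.mul_prod (memLp_affineWeight w).integrable_sq

/-- The operator `f ↦ f ⊗ w` from `L²` to the `L²` space over phase space and noise. -/
def tensorWeight (w : ℝ × ℝ × ℝ) : L2 T →L[ℝ] Lp ℝ 2 ((maxwellian T).prod noise) :=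
  LinearMap.mkContinuous
    { toFun := fun f => (memLp_mul_affineWeight w f).toLp _
      map_add' := by
        intro f g
        rw [← MemLp.toLp_add]
        refine MemLp.toLp_congr _ _ ?_
        filter_upwards [Measure.quasiMeasurePreserving_fst.ae (Lp.coeFn_add f g)] with z hz
        simp only [Pi.add_apply] at hz ⊢
        rw [hz, add_mul]
      map_smul' := by
        intro c f
        rw [RingHom.id_apply, ← MemLp.toLp_const_smul]
        refine MemLp.toLp_congr _ _ ?_
        filter_upwards [Measure.quasiMeasurePreserving_fst.ae (Lp.coeFn_smul c f)] with z hz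
        simp only [Pi.smul_apply, smul_eq_mul] at hz ⊢
        rw [hz, mul_assoc] }
    (Real.sqrt (w.1 ^ 2 + w.2.1 ^ 2 + w.2.2 ^ 2))
    (by
      intro f
      refine le_of_sq_le_sq ?_ (by positivity)
      rw [mul_pow, Real.sq_sqrt (by positivity)]
      simp only [LinearMap.coe_mk, AddHom.coe_mk]
      rw [← real_inner_self_eq_norm_sq, ← real_inner_self_eq_norm_sq, L2.inner_def,
        inner_eq_integral, ← integral_affineWeight_sq, mul_comm,
        ← integral_prod_mul (fun p => f p * f p) (fun y => affineWeight w y ^ 2)]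
      refine le_of_eq (integral_congr_ae ?_)
      filter_upwards [(memLp_mul_affineWeight w f).coeFn_toLp] with z hz
      rw [hz]
      simp only [RCLike.inner_apply, RCLike.conj_to_real]
      ring)

lemma coeFn_tensorWeight (w : ℝ × ℝ × ℝ) (f : L2 T) :
    tensorWeight w f =ᵐ[(maxwellian T).prod noise] fun z => f z.1 * affineWeight w z.2 :=
  (memLp_mul_affineWeight w f).coeFn_toLp

lemma norm_tensorWeight_le (w : ℝ × ℝ × ℝ) :
    ‖(tensorWeight w : L2 T →L[ℝ] _)‖ ≤ Real.sqrt (w.1 ^ 2 + w.2.1 ^ 2 + w.2.2 ^ 2) :=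
  LinearMap.mkContinuous_norm_le _ (by positivity) _

/-- The operator `f ↦ 𝔼 [f (flow σ t (·, Y)) w(Y)]` on `L²`, for times `t ≥ 0` (and `0` for `t < 0`).
Expressing the conditional expectation as an adjoint makes its boundedness evident. -/
def flowAverage (σ t : ℝ) (w : ℝ × ℝ × ℝ) : L2 T →L[ℝ] L2 T :=
  if ht : 0 ≤ t then
    (ContinuousLinearMap.adjoint (tensorWeight w)).comp
      (Lp.compMeasurePreservingₗᵢ ℝ (flow σ t)
        (measurePreserving_flow σ ht)).toContinuousLinearMap
  else 0

lemma norm_flowAverage_le (σ t : ℝ) (w : ℝ × ℝ × ℝ) (f : L2 T) :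
    ‖flowAverage σ t w f‖ ≤ Real.sqrt (w.1 ^ 2 + w.2.1 ^ 2 + w.2.2 ^ 2) * ‖f‖ := by
  unfold flowAverage
  split_ifs with ht
  · simp only [ContinuousLinearMap.comp_apply]
    refine (ContinuousLinearMap.le_opNorm _ _).trans ?_
    rw [LinearIsometryEquiv.norm_map]
    refine mul_le_mul (norm_tensorWeight_le w) (le_of_eq ?_) (norm_nonneg _) (by positivity)
    exact LinearIsometry.norm_map _ _
  · simp only [zero_apply, norm_zero]
    positivity

lemma flowAverage_trigL {t : ℝ} (ht : 0 ≤ t) (σ : ℝ) (w : ℝ × ℝ × ℝ) (n : ℤ) (ξ θ : ℝ) :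
    flowAverage σ t w (trigL T n ξ θ) =
      damping (σ * freq T n) ξ t • (w.1 • trigL T n (shiftFreq (σ * freq T n) ξ t) θ +
        (w.2.1 * (σ * freq T n * posStd t) +
          w.2.2 * (σ * freq T n * crossCoeff t + ξ * velStd t)) •
        trigL T n (shiftFreq (σ * freq T n) ξ t) (θ + Real.pi / 2)) := by
  refine ext_inner_right ℝ fun g => ?_
  rw [flowAverage, dif_pos ht, ContinuousLinearMap.comp_apply,
    ContinuousLinearMap.adjoint_inner_left, L2.inner_def, inner_smul_left, inner_add_left,
    inner_smul_left, inner_smul_left, real_inner_comm, inner_trigL, real_inner_comm, inner_trigL]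
  have hz : (fun z => inner ℝ (((Lp.compMeasurePreservingₗᵢ ℝ (flow σ t)
        (measurePreserving_flow σ ht)).toContinuousLinearMap (trigL T n ξ θ)) z)
        (tensorWeight w g z)) =ᵐ[(maxwellian T).prod noise]
      fun z => g z.1 * (trig n ξ θ (flow σ t z) * affineWeight w z.2) := by
    have h1 : ((Lp.compMeasurePreservingₗᵢ ℝ (flow σ t)
        (measurePreserving_flow σ ht)).toContinuousLinearMap (trigL T n ξ θ)) =ᵐ[
        (maxwellian T).prod noise] (trigL T n ξ θ) ∘ flow σ t :=
      Lp.coeFn_compMeasurePreserving _ (measurePreserving_flow σ ht)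
    filter_upwards [h1, coeFn_tensorWeight w g,
      (measurePreserving_flow σ ht).quasiMeasurePreserving.ae
        (memLp_trig (T := T) n ξ θ 2).coeFn_toLp] with z h1 h2 h3
    rw [h1, h2, Function.comp_apply, trigL, h3]
    simp
    ring
  rw [integral_congr_ae hz]
  have hi : Integrable (fun z : (AddCircle T × ℝ) × (ℝ × ℝ) =>
      g z.1 * (trig n ξ θ (flow σ t z) * affineWeight w z.2)) ((maxwellian T).prod noise) := by
    have h2 : Integrable (fun z : (AddCircle T × ℝ) × (ℝ × ℝ) => g z.1 * affineWeight w z.2)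
        ((maxwellian T).prod noise) := (memLp_mul_affineWeight w g).integrable (by norm_num)
    refine (h2.mul_bdd (c := 1) (g := fun z => trig n ξ θ (flow σ t z))
      ((continuous_trig n ξ θ).comp (continuous_flow σ t)).aestronglyMeasurable
      (Eventually.of_forall fun p => abs_trig_le_one n ξ θ _)).congr
      (Eventually.of_forall fun z => ?_)
    simp only
    ring
  rw [integral_prod _ hi]
  simp only [integral_const_mul, integral_trig_flow ht, RCLike.conj_to_real]
  set c := w.2.1 * (σ * freq T n * posStd t) + w.2.2 * (σ * freq T n * crossCoeff t + ξ * velStd t)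
  set ζ := shiftFreq (σ * freq T n) ξ t
  rw [← integral_const_mul, ← integral_const_mul, ← integral_add, ← integral_const_mul]
  · refine integral_congr_ae (Eventually.of_forall fun p => ?_)
    simp only
    ring
  · exact (integrable_L2_mul g (memLp_trig n ζ θ 2)).const_mul _
  · exact (integrable_L2_mul g (memLp_trig n ζ (θ + Real.pi / 2) 2)).const_mul _

end Flow

section Semigroup

variable {T : ℝ} [Fact (0 < T)]

/-! ### The semigroup and its adjoint -/

/-- The contraction semigroup with generator `-σ v ∂ₓ - (-∂ᵥ + v) ∂ᵥ`, for `t ≥ 0`. -/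
def fpSemigroup (σ t : ℝ) : L2 T →L[ℝ] L2 T := flowAverage σ t (1, 0, 0)

lemma norm_fpSemigroup_le (σ t : ℝ) (f : L2 T) : ‖fpSemigroup σ t f‖ ≤ ‖f‖ := by
  simpa [fpSemigroup] using norm_flowAverage_le σ t (1, 0, 0) f

lemma fpSemigroup_trigL {t : ℝ} (ht : 0 ≤ t) (σ : ℝ) (n : ℤ) (ξ θ : ℝ) :
    fpSemigroup σ t (trigL T n ξ θ) =
      damping (σ * freq T n) ξ t • trigL T n (shiftFreq (σ * freq T n) ξ t) θ := by
  rw [fpSemigroup, flowAverage_trigL ht]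
  simp

lemma damping_zero (z ξ : ℝ) : damping z ξ 0 = 1 := by simp [damping]

lemma shiftFreq_zero (z ξ : ℝ) : shiftFreq z ξ 0 = ξ := by simp [shiftFreq]

lemma fpSemigroup_zero (σ : ℝ) : fpSemigroup σ 0 = ContinuousLinearMap.id ℝ (L2 T) := by
  refine clm_ext_trig fun n ξ θ => ?_
  rw [fpSemigroup_trigL le_rfl, damping_zero, shiftFreq_zero, one_smul]
  rfl

lemma fpSemigroup_add (σ : ℝ) {s t : ℝ} (hs : 0 ≤ s) (ht : 0 ≤ t) :
    (fpSemigroup σ (s + t) : L2 T →L[ℝ] L2 T) = (fpSemigroup σ s).comp (fpSemigroup σ t) := by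
  refine clm_ext_trig fun n ξ θ => ?_
  rw [ContinuousLinearMap.comp_apply, fpSemigroup_trigL (by linarith), fpSemigroup_trigL ht,
    map_smul, fpSemigroup_trigL hs, smul_smul]
  have he : Real.exp (-(s + t)) = Real.exp (-s) * Real.exp (-t) := by
    rw [← Real.exp_add]; congr 1; ring
  have h1 : shiftFreq (σ * freq T n) (shiftFreq (σ * freq T n) ξ t) s =
      shiftFreq (σ * freq T n) ξ (s + t) := by
    simp only [shiftFreq, he]; ring
  have h2 : damping (σ * freq T n) ξ t *
      damping (σ * freq T n) (shiftFreq (σ * freq T n) ξ t) s =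
      damping (σ * freq T n) ξ (s + t) := by
    simp only [shiftFreq, damping, he]
    rw [← Real.exp_add]
    congr 1
    ring
  rw [h1, h2]

lemma inner_trigL_trigL (n n' : ℤ) (ξ ξ' θ θ' : ℝ) :
    inner ℝ (trigL T n ξ θ) (trigL T n' ξ' θ') =
      (1 / 2) * ((if n - n' = 0 then Real.exp (-(ξ - ξ') ^ 2 / 2) * Real.cos (θ - θ') else 0) +
        if n + n' = 0 then Real.exp (-(ξ + ξ') ^ 2 / 2) * Real.cos (θ + θ') else 0) := by
  rw [inner_trigL, ← integral_trig (T := T), ← integral_trig (T := T),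
    ← integral_add ((memLp_trig _ _ _ 1).integrable le_rfl)
      ((memLp_trig _ _ _ 1).integrable le_rfl), ← integral_const_mul]
  refine integral_congr_ae ?_
  filter_upwards [(memLp_trig (T := T) n ξ θ 2).coeFn_toLp] with p hp
  rw [trigL, hp, trig_mul_trig]

/-- The adjoint of the semigroup is obtained by reversing the direction of transport. -/
lemma inner_fpSemigroup_left {t : ℝ} (ht : 0 ≤ t) (σ : ℝ) (f g : L2 T) :
    inner ℝ (fpSemigroup σ t f) g = inner ℝ f (fpSemigroup (-σ) t g) := by
  have htrig : ∀ (n n' : ℤ) (ξ ξ' θ θ' : ℝ),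
      inner ℝ (fpSemigroup σ t (trigL T n ξ θ)) (trigL T n' ξ' θ') =
        inner ℝ (trigL T n ξ θ) (fpSemigroup (-σ) t (trigL T n' ξ' θ')) := by
    intro n n' ξ ξ' θ θ'
    rw [fpSemigroup_trigL ht, fpSemigroup_trigL ht, real_inner_smul_left, real_inner_smul_right,
      inner_trigL_trigL, inner_trigL_trigL]
    -- the two exponents agree as quadratic polynomials in `ξ` and `ξ'`
    have e1 : n - n' = 0 → damping (σ * freq T n) ξ t *
        Real.exp (-(shiftFreq (σ * freq T n) ξ t - ξ') ^ 2 / 2) =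
        damping (-σ * freq T n') ξ' t *
        Real.exp (-(ξ - shiftFreq (-σ * freq T n') ξ' t) ^ 2 / 2) := by
      intro h
      obtain rfl : n = n' := by omega
      simp only [damping, shiftFreq]
      rw [← Real.exp_add, ← Real.exp_add]
      congr 1
      ring
    have e2 : n + n' = 0 → damping (σ * freq T n) ξ t *
        Real.exp (-(shiftFreq (σ * freq T n) ξ t + ξ') ^ 2 / 2) =
        damping (-σ * freq T n') ξ' t *
        Real.exp (-(ξ + shiftFreq (-σ * freq T n') ξ' t) ^ 2 / 2) := by
      intro h
      obtain rfl : n' = -n := by omega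
      simp only [damping, shiftFreq, freq_neg]
      rw [← Real.exp_add, ← Real.exp_add]
      congr 1
      ring
    split_ifs with h1 h2 h2
    · linear_combination (1 / 2 * Real.cos (θ - θ')) * e1 h1 + (1 / 2 * Real.cos (θ + θ')) * e2 h2
    · linear_combination (1 / 2 * Real.cos (θ - θ')) * e1 h1
    · linear_combination (1 / 2 * Real.cos (θ + θ')) * e2 h2
    · simp
  have h1 : ∀ n' ξ' θ', inner ℝ (fpSemigroup σ t f) (trigL T n' ξ' θ') =
      inner ℝ f (fpSemigroup (-σ) t (trigL T n' ξ' θ')) := by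
    intro n' ξ' θ'
    have : ((innerSL ℝ (trigL T n' ξ' θ')).comp (fpSemigroup σ t) : L2 T →L[ℝ] ℝ) =
        innerSL ℝ (fpSemigroup (-σ) t (trigL T n' ξ' θ')) := by
      refine clm_ext_trig fun n ξ θ => ?_
      simp only [ContinuousLinearMap.comp_apply, innerSL_apply_apply]
      rw [real_inner_comm, htrig, real_inner_comm]
    have h2 := congrArg (fun A : L2 T →L[ℝ] ℝ => A f) this
    simp only [ContinuousLinearMap.comp_apply, innerSL_apply_apply] at h2
    rw [real_inner_comm, h2, real_inner_comm]
  have h3 : (innerSL ℝ (fpSemigroup σ t f) : L2 T →L[ℝ] ℝ) =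
      (innerSL ℝ f).comp (fpSemigroup (-σ) t) := by
    refine clm_ext_trig fun n ξ θ => ?_
    simp only [ContinuousLinearMap.comp_apply, innerSL_apply_apply]
    exact h1 n ξ θ
  have h4 := congrArg (fun A : L2 T →L[ℝ] ℝ => A g) h3
  simpa only [ContinuousLinearMap.comp_apply, innerSL_apply_apply] using h4

/-! ### Weak time derivatives -/

lemma memLp_velocity : MemLp (fun p : AddCircle T × ℝ => p.2) 2 (maxwellian T) :=
  memLp_id_stdGauss.comp_measurePreserving measurePreserving_snd

lemma memLp_velocity_mul_trig (n : ℤ) (ξ θ : ℝ) :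
    MemLp (fun p : AddCircle T × ℝ => p.2 * trig n ξ θ p) 2 (maxwellian T) := by
  refine memLp_velocity.mono (by
    exact (continuous_snd.mul (continuous_trig n ξ θ)).aestronglyMeasurable)
    (Eventually.of_forall fun p => ?_)
  rw [norm_mul]
  exact mul_le_of_le_one_right (norm_nonneg _) (abs_trig_le_one n ξ θ p)

lemma hasDerivAt_integral_mul_trig (f : L2 T) (n : ℤ) (ξ θ : ℝ) :
    HasDerivAt (fun ζ => ∫ p, f p * trig n ζ θ p ∂(maxwellian T))
      (∫ p, f p * (p.2 * trig n ξ (θ + Real.pi / 2) p) ∂(maxwellian T)) ξ := by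
  refine (hasDerivAt_integral_of_dominated_loc_of_deriv_le (s := Set.univ)
    (bound := fun p => |f p * p.2|) Filter.univ_mem
    (Eventually.of_forall fun ζ => (integrable_L2_mul f (memLp_trig n ζ θ 2)).1)
    (integrable_L2_mul f (memLp_trig n ξ θ 2))
    (integrable_L2_mul f (memLp_velocity_mul_trig n ξ _)).1
    (Eventually.of_forall fun p ζ _ => ?_)
    (integrable_L2_mul f memLp_velocity).abs
    (Eventually.of_forall fun p ζ _ => (hasDerivAt_trig_freq n ζ θ p).const_mul (f p))).2
  rw [Real.norm_eq_abs, ← mul_assoc, abs_mul]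
  exact mul_le_of_le_one_right (abs_nonneg _) (abs_trig_le_one _ _ _ _)

lemma hasDerivAt_shiftFreq (z ξ t : ℝ) :
    HasDerivAt (shiftFreq z ξ) (-(shiftFreq z ξ t + z)) t := by
  have := ((hasDerivAt_exp_neg t).mul_const ξ).sub
    (((hasDerivAt_exp_neg t).const_sub 1).mul_const z)
  refine HasDerivAt.congr_deriv (f := shiftFreq z ξ) this ?_
  simp only [shiftFreq]
  ring

lemma hasDerivAt_damping (z ξ t : ℝ) :
    HasDerivAt (damping z ξ) (-(shiftFreq z ξ t) ^ 2 * damping z ξ t) t := by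
  have h := ((((hasDerivAt_id t).const_mul (z ^ 2)).sub
    (((hasDerivAt_exp_neg t).const_sub 1).const_mul (2 * z * (ξ + z)))).add
    (((((hasDerivAt_exp_neg t).pow 2).const_sub 1).const_mul ((ξ + z) ^ 2)).div_const 2)).neg.exp
  refine HasDerivAt.congr_deriv (f := damping z ξ) h ?_
  simp only [damping, shiftFreq, Pi.neg_apply, Pi.add_apply, Pi.sub_apply, id, Pi.pow_apply]
  rw [mul_comm]
  congr 1
  push_cast
  ring

/-- The result of applying `-σ v ∂ₓ - (-∂ᵥ + v) ∂ᵥ` to `trig n ξ θ`. -/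
def genTrig (σ : ℝ) (n : ℤ) (ξ θ : ℝ) (p : AddCircle T × ℝ) : ℝ :=
  -(σ * freq T n + ξ) * (p.2 * trig n ξ (θ + Real.pi / 2) p) - ξ ^ 2 * trig n ξ θ p

lemma memLp_genTrig (σ : ℝ) (n : ℤ) (ξ θ : ℝ) :
    MemLp (genTrig σ n ξ θ : AddCircle T × ℝ → ℝ) 2 (maxwellian T) :=
  ((memLp_velocity_mul_trig n ξ _).const_mul _).sub ((memLp_trig n ξ θ 2).const_mul _)

lemma integral_mul_genTrig (f : L2 T) (σ : ℝ) (n : ℤ) (ξ θ : ℝ) :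
    ∫ p, f p * genTrig σ n ξ θ p ∂(maxwellian T) =
      -(σ * freq T n + ξ) * ∫ p, f p * (p.2 * trig n ξ (θ + Real.pi / 2) p) ∂(maxwellian T) -
        ξ ^ 2 * ∫ p, f p * trig n ξ θ p ∂(maxwellian T) := by
  rw [← integral_const_mul, ← integral_const_mul, ← integral_sub
    ((integrable_L2_mul f (memLp_velocity_mul_trig n ξ _)).const_mul _)
    ((integrable_L2_mul f (memLp_trig n ξ θ 2)).const_mul _)]
  refine integral_congr_ae (Eventually.of_forall fun p => ?_)
  simp only [genTrig]
  ring

lemma inner_fpSemigroup_trigL {t : ℝ} (ht : 0 ≤ t) (σ : ℝ) (f : L2 T) (n : ℤ) (ξ θ : ℝ) :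
    inner ℝ (fpSemigroup σ t f) (trigL T n ξ θ) = damping (-σ * freq T n) ξ t *
      ∫ p, f p * trig n (shiftFreq (-σ * freq T n) ξ t) θ p ∂(maxwellian T) := by
  rw [inner_fpSemigroup_left ht, fpSemigroup_trigL ht, real_inner_smul_right, inner_trigL]

/-- If `g` is the image of `f` under the generator, weakly against trigonometric functions, then
`t ↦ ⟪S t f, e⟫` is differentiable with derivative `⟪S t g, e⟫`. -/
lemma hasDerivWithinAt_inner_fpSemigroup {σ : ℝ} {f g : L2 T}
    (h : ∀ n ξ θ, ∫ p, f p * genTrig (-σ) n ξ θ p ∂(maxwellian T) =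
      ∫ p, g p * trig n ξ θ p ∂(maxwellian T)) {e : L2 T} (he : e ∈ trigSpan T) {t : ℝ}
    (ht : 0 ≤ t) :
    HasDerivWithinAt (fun s => inner ℝ (fpSemigroup σ s f) e) (inner ℝ (fpSemigroup σ t g) e)
      (Set.Ici 0) t := by
  induction he using Submodule.span_induction with
  | mem e he =>
    obtain ⟨⟨n, ξ, θ⟩, rfl⟩ := he
    simp only
    have hd := (hasDerivAt_damping (-σ * freq T n) ξ t).mul
      ((hasDerivAt_integral_mul_trig f n (shiftFreq (-σ * freq T n) ξ t) θ).comp t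
        (hasDerivAt_shiftFreq (-σ * freq T n) ξ t))
    refine (hd.hasDerivWithinAt.congr_deriv ?_).congr_of_mem (fun s hs => ?_) ht
    · rw [inner_fpSemigroup_trigL ht, ← h, integral_mul_genTrig]
      simp only [Function.comp_apply]
      ring
    · rw [inner_fpSemigroup_trigL hs]
      rfl
  | zero => simpa using hasDerivWithinAt_const t (Set.Ici (0 : ℝ)) (0 : ℝ)
  | add e e' _ _ h1 h2 =>
    simp only [inner_add_right]
    exact h1.add h2
  | smul c e _ h1 =>
    simp only [real_inner_smul_right]
    exact h1.const_mul c

/-- Strong continuity: for contractions it follows from weak continuity, which is explicit on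
trigonometric functions. -/
lemma tendsto_fpSemigroup (σ : ℝ) (f : L2 T) :
    Tendsto (fun t => fpSemigroup σ t f) (𝓝[>] 0) (𝓝 f) := by
  have htrig : ∀ n ξ θ, Tendsto (fun t => fpSemigroup σ t (trigL T n ξ θ)) (𝓝[>] 0)
      (𝓝 (trigL T n ξ θ)) := by
    intro n ξ θ
    set e := trigL T n ξ θ with he
    have hweak : Tendsto (fun t => inner ℝ (fpSemigroup σ t e) e) (𝓝[>] 0) (𝓝 (inner ℝ e e)) := by
      have hc : ContinuousAt (fun t => damping (-σ * freq T n) ξ t *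
          ∫ p, e p * trig n (shiftFreq (-σ * freq T n) ξ t) θ p ∂(maxwellian T)) 0 :=
        (hasDerivAt_damping (-σ * freq T n) ξ 0).continuousAt.mul
          ((hasDerivAt_integral_mul_trig e n (shiftFreq (-σ * freq T n) ξ 0) θ).comp 0
            (hasDerivAt_shiftFreq (-σ * freq T n) ξ 0)).continuousAt
      have hc' := hc.tendsto
      rw [damping_zero, shiftFreq_zero, one_mul, ← inner_trigL] at hc'
      refine (hc'.mono_left nhdsWithin_le_nhds).congr' ?_
      filter_upwards [self_mem_nhdsWithin] with t ht
      rw [he, inner_fpSemigroup_trigL (le_of_lt ht)]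
    rw [tendsto_iff_norm_sub_tendsto_zero]
    have h2 : Tendsto (fun t => Real.sqrt (2 * inner ℝ e e - 2 * inner ℝ (fpSemigroup σ t e) e))
        (𝓝[>] 0) (𝓝 0) := by
      have := ((hweak.const_mul 2).const_sub (2 * inner ℝ e e)).sqrt
      simpa using this
    refine squeeze_zero (fun t => norm_nonneg _) (fun t => ?_) h2
    refine Real.le_sqrt_of_sq_le ?_
    rw [norm_sub_sq_real, real_inner_self_eq_norm_sq]
    have := norm_fpSemigroup_le σ t e
    nlinarith [norm_nonneg (fpSemigroup σ t e), norm_nonneg e]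
  have hspan : ∀ e ∈ trigSpan T, Tendsto (fun t => fpSemigroup σ t e) (𝓝[>] 0) (𝓝 e) := by
    intro e he
    induction he using Submodule.span_induction with
    | mem e he =>
      obtain ⟨⟨n, ξ, θ⟩, rfl⟩ := he
      exact htrig n ξ θ
    | zero => simp
    | add e e' _ _ h1 h2 => simpa only [map_add] using h1.add h2
    | smul c e _ h1 => simpa only [map_smul] using h1.const_smul c
  rw [Metric.tendsto_nhds]
  intro ε hε
  obtain ⟨e, he, hfe⟩ := Metric.dense_iff.1 dense_trigSpan f (ε / 3) (by positivity)
  filter_upwards [Metric.tendsto_nhds.1 (hspan e hfe) (ε / 3) (by positivity)] with t ht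
  rw [Metric.mem_ball] at he
  have h1 : dist (fpSemigroup σ t f) (fpSemigroup σ t e) ≤ dist f e := by
    rw [dist_eq_norm, dist_eq_norm, ← map_sub]
    exact norm_fpSemigroup_le _ _ _
  have h2 := dist_triangle4 (fpSemigroup σ t f) (fpSemigroup σ t e) e f
  rw [dist_comm f e] at h1
  linarith

/-- A function whose image under the generator exists weakly, against trigonometric functions only,
is in the domain of the generator. -/
lemma tendsto_diffQuot_fpSemigroup {σ : ℝ} {f g : L2 T}
    (h : ∀ n ξ θ, ∫ p, f p * genTrig (-σ) n ξ θ p ∂(maxwellian T) =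
      ∫ p, g p * trig n ξ θ p ∂(maxwellian T)) :
    Tendsto (fun t : ℝ => t⁻¹ • (fpSemigroup σ t f - f)) (𝓝[>] 0) (𝓝 g) := by
  rw [Metric.tendsto_nhds]
  intro ε hε
  obtain ⟨δ, hδ, hball⟩ := Metric.mem_nhdsWithin_iff.1
    (Metric.tendsto_nhds.1 (tendsto_fpSemigroup σ g) (ε / 2) (by positivity))
  have hlt : ∀ᶠ t : ℝ in 𝓝[>] 0, t < δ :=
    nhdsWithin_le_nhds (eventually_lt_nhds hδ)
  filter_upwards [hlt, self_mem_nhdsWithin] with t htδ ht0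
  have ht : 0 < t := ht0
  have hbd : ∀ s ∈ Set.Icc 0 t, ‖fpSemigroup σ s g - g‖ ≤ ε / 2 := by
    intro s hs
    rcases hs.1.eq_or_lt with rfl | hs0
    · rw [fpSemigroup_zero]
      simp only [ContinuousLinearMap.id_apply, sub_self, norm_zero]
      positivity
    · have : s ∈ Metric.ball (0 : ℝ) δ ∩ Set.Ioi 0 := by
        refine ⟨?_, hs0⟩
        rw [Metric.mem_ball, Real.dist_eq, sub_zero, abs_of_pos hs0]
        exact hs.2.trans_lt htδ
      have h3 := hball this
      rw [Set.mem_ofPred_eq, dist_eq_norm] at h3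
      exact h3.le
  have hmain : ‖fpSemigroup σ t f - f - t • g‖ ≤ ε / 2 * t := by
    refine norm_le_of_forall_trigSpan _ _ fun e he => ?_
    have hder : ∀ s ∈ Set.Icc 0 t, HasDerivWithinAt
        (fun s => inner ℝ (fpSemigroup σ s f) e - s * inner ℝ g e)
        (inner ℝ (fpSemigroup σ s g - g) e) (Set.Icc 0 t) s := by
      intro s hs
      have h1 := (hasDerivWithinAt_inner_fpSemigroup h he hs.1).mono
        (Set.Icc_subset_Ici_self : Set.Icc 0 t ⊆ Set.Ici 0)
      have h2 := ((hasDerivAt_id s).mul_const (inner ℝ g e)).hasDerivWithinAt (s := Set.Icc 0 t)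
      refine (h1.sub h2).congr_deriv ?_
      rw [inner_sub_left, one_mul]
    have h4 := (convex_Icc (0 : ℝ) t).norm_image_sub_le_of_norm_hasDerivWithin_le hder
      (C := ε / 2 * ‖e‖) (fun s hs => (norm_inner_le_norm _ _).trans
        (mul_le_mul_of_nonneg_right (hbd s hs) (norm_nonneg _)))
      (Set.left_mem_Icc.2 ht.le) (Set.right_mem_Icc.2 ht.le)
    rw [fpSemigroup_zero] at h4
    simp only [ContinuousLinearMap.id_apply, zero_mul, sub_zero, Real.norm_eq_abs,
      abs_of_pos ht] at h4
    rw [inner_sub_left, inner_sub_left, real_inner_smul_left]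
    have := le_of_abs_le h4
    linarith
  rw [dist_eq_norm]
  have h5 : t⁻¹ • (fpSemigroup σ t f - f) - g = t⁻¹ • (fpSemigroup σ t f - f - t • g) := by
    rw [smul_sub t⁻¹ (fpSemigroup σ t f - f) (t • g), inv_smul_smul₀ ht.ne']
  rw [h5, norm_smul, norm_inv, Real.norm_eq_abs, abs_of_pos ht, inv_mul_lt_iff₀ ht]
  nlinarith

end Semigroup

section TestFunctions

variable {T : ℝ}

/-! ### Test functions and integration by parts -/

lemma IsTest.differentiable {φ : AddCircle T × ℝ → ℝ} (hφ : IsTest φ) :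
    Differentiable ℝ (fun p : ℝ × ℝ => φ ((p.1 : AddCircle T), p.2)) :=
  hφ.smooth.differentiable (by simp)

lemma IsTest.hasDerivAt_velocity {φ : AddCircle T × ℝ → ℝ} (hφ : IsTest φ) (x : AddCircle T)
    (v : ℝ) : HasDerivAt (fun w => φ (x, w)) (dv φ (x, v)) v := by
  obtain ⟨x, rfl⟩ := QuotientAddGroup.mk_surjective x
  have hd : DifferentiableAt ℝ (fun w : ℝ => φ ((x : AddCircle T), w)) v :=
    (hφ.differentiable (x, v)).comp v (f := fun w : ℝ => (x, w))
      ((differentiableAt_const x).prodMk differentiableAt_id)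
  exact hd.hasDerivAt

lemma IsTest.hasDerivAt_position {φ : AddCircle T × ℝ → ℝ} (hφ : IsTest φ) (x v : ℝ) :
    HasDerivAt (fun s : ℝ => φ ((s : AddCircle T), v)) (dx φ ((x : AddCircle T), v)) x := by
  have hd : Differentiable ℝ (fun s : ℝ => φ ((s : AddCircle T), v)) := fun s =>
    (hφ.differentiable (s, v)).comp s (f := fun w : ℝ => (w, v))
      (differentiableAt_id.prodMk (differentiableAt_const v))
  have h1 : dx φ ((x : AddCircle T), v) = deriv (fun s : ℝ => φ ((s : AddCircle T), v)) x := by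
    have := deriv_comp_const_add (f := fun s : ℝ => φ ((s : AddCircle T), v)) x 0
    rw [add_zero] at this
    rw [← this]
    simp only [dx, AddCircle.coe_add]
  rw [h1]
  exact (hd x).hasDerivAt

lemma IsTest.continuous {φ : AddCircle T × ℝ → ℝ} (hφ : IsTest φ) : Continuous φ := by
  have hq : IsOpenQuotientMap (Prod.map (fun x : ℝ => (x : AddCircle T)) (id : ℝ → ℝ)) :=
    (QuotientAddGroup.isOpenQuotientMap_mk (G := ℝ)).prodMap .id
  exact hq.isQuotientMap.continuous_iff.2 hφ.smooth.continuous

lemma IsTest.dx_coe {φ : AddCircle T × ℝ → ℝ} (hφ : IsTest φ) (p : ℝ × ℝ) :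
    dx φ ((p.1 : AddCircle T), p.2) =
      fderiv ℝ (fun p : ℝ × ℝ => φ ((p.1 : AddCircle T), p.2)) p (1, 0) :=
  (hφ.hasDerivAt_position p.1 p.2).unique
    ((hφ.differentiable p).hasFDerivAt.comp_hasDerivAt p.1 (f := fun s : ℝ => (s, p.2))
      ((hasDerivAt_id p.1).prodMk (hasDerivAt_const p.1 p.2)))

lemma IsTest.dv_coe {φ : AddCircle T × ℝ → ℝ} (hφ : IsTest φ) (p : ℝ × ℝ) :
    dv φ ((p.1 : AddCircle T), p.2) =
      fderiv ℝ (fun p : ℝ × ℝ => φ ((p.1 : AddCircle T), p.2)) p (0, 1) :=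
  (hφ.hasDerivAt_velocity p.1 p.2).unique
    ((hφ.differentiable p).hasFDerivAt.comp_hasDerivAt p.2 (f := fun w : ℝ => (p.1, w))
      ((hasDerivAt_const p.2 p.1).prodMk (hasDerivAt_id p.2)))

lemma IsTest.dx {φ : AddCircle T × ℝ → ℝ} (hφ : IsTest φ) : IsTest (dx φ) where
  smooth := by
    simp only [hφ.dx_coe]
    exact (hφ.smooth.fderiv_right (m := ∞) (by simp)).clm_apply contDiff_const
  compact := by
    refine HasCompactSupport.intro hφ.compact fun p hp => ?_
    have h0 : Tendsto (fun s : ℝ => (p.1 + (s : AddCircle T), p.2)) (𝓝 0) (𝓝 p) := by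
      have hc : Continuous (fun s : ℝ => (p.1 + (s : AddCircle T), p.2)) := by
        have : Continuous (fun x : ℝ => (x : AddCircle T)) := AddCircle.continuous_mk' T
        fun_prop
      simpa using hc.tendsto 0
    have h1 : (fun s : ℝ => φ (p.1 + (s : AddCircle T), p.2)) =ᶠ[𝓝 0] fun _ => 0 :=
      h0.eventually (notMem_tsupport_iff_eventuallyEq.1 hp)
    rw [FokkerPlanck.dx, h1.deriv_eq, deriv_const]

lemma IsTest.dv {φ : AddCircle T × ℝ → ℝ} (hφ : IsTest φ) : IsTest (dv φ) where
  smooth := by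
    simp only [hφ.dv_coe]
    exact (hφ.smooth.fderiv_right (m := ∞) (by simp)).clm_apply contDiff_const
  compact := by
    refine HasCompactSupport.intro hφ.compact fun p hp => ?_
    have h0 : Tendsto (fun w : ℝ => (p.1, w)) (𝓝 p.2) (𝓝 p) :=
      (Continuous.prodMk_right p.1).tendsto p.2
    have h1 : (fun w : ℝ => φ (p.1, w)) =ᶠ[𝓝 p.2] fun _ => 0 :=
      h0.eventually (notMem_tsupport_iff_eventuallyEq.1 hp)
    rw [FokkerPlanck.dv, h1.deriv_eq, deriv_const]

lemma IsTest.mul_right {φ ψ : AddCircle T × ℝ → ℝ} (hφ : IsTest φ)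
    (hψ : ContDiff ℝ ∞ (fun p : ℝ × ℝ => ψ ((p.1 : AddCircle T), p.2))) :
    IsTest (fun p => φ p * ψ p) where
  smooth := hφ.smooth.mul hψ
  compact := hφ.compact.mul_right

lemma contDiff_trig (n : ℤ) (ξ θ : ℝ) :
    ContDiff ℝ ∞ (fun p : ℝ × ℝ => trig n ξ θ ((p.1 : AddCircle T), p.2)) := by
  simp only [trig_coe]
  fun_prop

lemma IsTest.velocity_mul {φ : AddCircle T × ℝ → ℝ} (hφ : IsTest φ) :
    IsTest (fun p => φ p * p.2) :=
  hφ.mul_right contDiff_snd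

lemma IsTest.exists_bound {φ : AddCircle T × ℝ → ℝ} (hφ : IsTest φ) : ∃ C, ∀ p, ‖φ p‖ ≤ C :=
  hφ.compact.exists_bound_of_continuous hφ.continuous

lemma IsTest.dv_mul_trig {φ : AddCircle T × ℝ → ℝ} (hφ : IsTest φ) (n : ℤ) (ξ θ : ℝ)
    (p : AddCircle T × ℝ) : FokkerPlanck.dv (fun p => φ p * trig n ξ θ p) p =
      FokkerPlanck.dv φ p * trig n ξ θ p + φ p * (ξ * trig n ξ (θ + Real.pi / 2) p) :=
  ((hφ.hasDerivAt_velocity p.1 p.2).mul (hasDerivAt_trig_velocity n ξ θ p.1 p.2)).deriv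

lemma IsTest.dx_mul_trig {φ : AddCircle T × ℝ → ℝ} (hφ : IsTest φ) (n : ℤ) (ξ θ : ℝ)
    (p : AddCircle T × ℝ) : FokkerPlanck.dx (fun p => φ p * trig n ξ θ p) p =
      FokkerPlanck.dx φ p * trig n ξ θ p + φ p * (freq T n * trig n ξ (θ + Real.pi / 2) p) := by
  obtain ⟨x, v, rfl⟩ := exists_coe_eq p
  exact ((hφ.mul_right (contDiff_trig n ξ θ)).hasDerivAt_position x v).unique
    ((hφ.hasDerivAt_position x v).mul (hasDerivAt_trig_position n ξ θ x v))

variable [Fact (0 < T)]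

lemma IsTest.memLp {φ : AddCircle T × ℝ → ℝ} (hφ : IsTest φ) (q : ENNReal) :
    MemLp φ q (maxwellian T) := by
  obtain ⟨C, hC⟩ := hφ.exists_bound
  exact MemLp.of_bound hφ.continuous.aestronglyMeasurable C (Eventually.of_forall hC)

lemma IsTest.memLp_dvAdj {φ : AddCircle T × ℝ → ℝ} (hφ : IsTest φ) (q : ENNReal) :
    MemLp (dvAdj φ) q (maxwellian T) := by
  refine ((hφ.dv.memLp q).neg.add (hφ.velocity_mul.memLp q)).congr_norm ?_ ?_
  · have : dvAdj φ = fun p => -FokkerPlanck.dv φ p + φ p * p.2 := by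
      ext p
      simp only [dvAdj]
      ring
    rw [this]
    exact (hφ.dv.continuous.neg.add hφ.velocity_mul.continuous).aestronglyMeasurable
  · refine Eventually.of_forall fun p => ?_
    simp [dvAdj, mul_comm]

lemma IsTest.memLp_fpAdj {φ : AddCircle T × ℝ → ℝ} (hφ : IsTest φ) (q : ENNReal) :
    MemLp (fpAdj φ) q (maxwellian T) := by
  have h := (hφ.dx.velocity_mul.memLp (T := T) q).neg.add (hφ.dv.memLp_dvAdj q)
  refine (memLp_congr_ae (Eventually.of_forall fun p => ?_)).1 h
  simp [fpAdj, mul_comm]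

lemma IsTest.integral_dx {φ : AddCircle T × ℝ → ℝ} (hφ : IsTest φ) :
    ∫ p, FokkerPlanck.dx φ p ∂(maxwellian T) = 0 := by
  have hi := (hφ.dx.memLp (T := T) 1).integrable le_rfl
  rw [maxwellian] at hi ⊢
  rw [integral_prod_symm _ hi]
  refine integral_eq_zero_of_ae (Eventually.of_forall fun v => ?_)
  simp only [Pi.zero_apply]
  have hc : Continuous (fun x : ℝ => FokkerPlanck.dx φ ((x : AddCircle T), v)) :=
    hφ.dx.smooth.continuous.comp (Continuous.prodMk_left v)
  rw [AddCircle.integral_haarAddCircle, ← AddCircle.intervalIntegral_preimage T 0,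
    intervalIntegral.integral_eq_sub_of_hasDerivAt
      (f := fun x : ℝ => φ ((x : AddCircle T), v)) (fun x _ => hφ.hasDerivAt_position x v)
      (hc.intervalIntegrable _ _), zero_add, AddCircle.coe_period, AddCircle.coe_zero, sub_self,
    smul_zero]

lemma IsTest.integral_dvAdj {φ : AddCircle T × ℝ → ℝ} (hφ : IsTest φ) :
    ∫ p, dvAdj φ p ∂(maxwellian T) = 0 := by
  have hi := (hφ.memLp_dvAdj (T := T) 1).integrable le_rfl
  rw [maxwellian] at hi ⊢
  rw [integral_prod _ hi]
  refine integral_eq_zero_of_ae (Eventually.of_forall fun x => ?_)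
  have hint : ∀ {ψ : AddCircle T × ℝ → ℝ}, IsTest ψ →
      Integrable (fun v => ψ (x, v)) stdGauss := by
    intro ψ hψ
    obtain ⟨C, hC⟩ := hψ.exists_bound
    exact Integrable.of_bound
      (hψ.continuous.comp (Continuous.prodMk_right x)).aestronglyMeasurable C
      (Eventually.of_forall fun v => hC _)
  have h2 : Integrable (fun v => v * φ (x, v)) stdGauss := by
    simpa only [mul_comm] using hint hφ.velocity_mul
  have := integral_deriv_stdGauss (fun v => hφ.hasDerivAt_velocity x v) (hint hφ) (hint hφ.dv) h2
  simp only [Pi.zero_apply, dvAdj]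
  rw [integral_add (hint hφ.dv).fun_neg h2, integral_neg, this]
  simp

lemma IsTest.integral_trig_mul_dx {φ : AddCircle T × ℝ → ℝ} (hφ : IsTest φ) (n : ℤ) (ξ θ : ℝ) :
    ∫ p, trig n ξ θ p * (-FokkerPlanck.dx φ p) ∂(maxwellian T) =
      freq T n * ∫ p, trig n ξ (θ + Real.pi / 2) p * φ p ∂(maxwellian T) := by
  have h0 := (hφ.mul_right (contDiff_trig n ξ θ)).integral_dx
  have i1 : Integrable (fun p => trig n ξ (θ + Real.pi / 2) p * φ p) (maxwellian T) :=
    (memLp_trig n ξ _ 2).integrable_mul (hφ.memLp 2)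
  have i2 : Integrable (fun p => trig n ξ θ p * (-FokkerPlanck.dx φ p)) (maxwellian T) :=
    (memLp_trig n ξ _ 2).integrable_mul (hφ.dx.memLp 2).neg
  rw [← integral_const_mul, ← sub_eq_zero, ← integral_sub i2 (i1.const_mul _), ← neg_eq_zero,
    ← integral_neg, ← h0]
  refine integral_congr_ae (Eventually.of_forall fun p => ?_)
  simp only [hφ.dx_mul_trig]
  ring

lemma IsTest.integral_trig_mul_dvAdj {φ : AddCircle T × ℝ → ℝ} (hφ : IsTest φ) (n : ℤ)
    (ξ θ : ℝ) : ∫ p, trig n ξ θ p * dvAdj φ p ∂(maxwellian T) =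
      ξ * ∫ p, trig n ξ (θ + Real.pi / 2) p * φ p ∂(maxwellian T) := by
  have h0 := (hφ.mul_right (contDiff_trig n ξ θ)).integral_dvAdj
  have i1 : Integrable (fun p => trig n ξ (θ + Real.pi / 2) p * φ p) (maxwellian T) :=
    (memLp_trig n ξ _ 2).integrable_mul (hφ.memLp 2)
  have i2 : Integrable (fun p => trig n ξ θ p * dvAdj φ p) (maxwellian T) :=
    (memLp_trig n ξ _ 2).integrable_mul (hφ.memLp_dvAdj 2)
  rw [← integral_const_mul, ← sub_eq_zero, ← integral_sub i2 (i1.const_mul _), ← h0]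
  refine integral_congr_ae (Eventually.of_forall fun p => ?_)
  simp only [dvAdj, hφ.dv_mul_trig]
  ring

/-- Duality between `P*` on test functions and `-P` on trigonometric functions. -/
lemma IsTest.integral_trig_mul_fpAdj {φ : AddCircle T × ℝ → ℝ} (hφ : IsTest φ) (n : ℤ)
    (ξ θ : ℝ) : ∫ p, trig n ξ θ p * fpAdj φ p ∂(maxwellian T) =
      - ∫ p, φ p * genTrig 1 n ξ θ p ∂(maxwellian T) := by
  have i0 : ∀ {ψ : AddCircle T × ℝ → ℝ}, MemLp ψ 2 (maxwellian T) → ∀ θ,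
      Integrable (fun p => trig n ξ θ p * ψ p) (maxwellian T) :=
    fun hψ θ => (memLp_trig n ξ θ 2).integrable_mul hψ
  -- the transport term
  have h1 : ∫ p, trig n ξ θ p * (-(p.2 * FokkerPlanck.dx φ p)) ∂(maxwellian T) =
      freq T n * ∫ p, trig n ξ (θ + Real.pi / 2) p * (φ p * p.2) ∂(maxwellian T) := by
    rw [← hφ.velocity_mul.integral_trig_mul_dx]
    refine integral_congr_ae (Eventually.of_forall fun p => ?_)
    obtain ⟨x, v, rfl⟩ := exists_coe_eq p
    simp only
    rw [(hφ.velocity_mul.hasDerivAt_position x v).unique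
      ((hφ.hasDerivAt_position x v).mul_const v)]
    ring
  -- the diffusive term, integrating by parts twice
  have h2 := hφ.dv.integral_trig_mul_dvAdj n ξ θ
  have h3 := hφ.integral_trig_mul_dvAdj n ξ (θ + Real.pi / 2)
  have h4 : ∫ p, trig n ξ (θ + Real.pi / 2) p * dvAdj φ p ∂(maxwellian T) =
      ∫ p, trig n ξ (θ + Real.pi / 2) p * (φ p * p.2) ∂(maxwellian T) -
        ∫ p, trig n ξ (θ + Real.pi / 2) p * FokkerPlanck.dv φ p ∂(maxwellian T) := by
    rw [← integral_sub (i0 (hφ.velocity_mul.memLp 2) _) (i0 (hφ.dv.memLp 2) _)]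
    refine integral_congr_ae (Eventually.of_forall fun p => ?_)
    simp only [dvAdj]
    ring
  simp only [trig_add_pi, neg_mul, integral_neg] at h3
  have h5 : ∫ p, trig n ξ θ p * fpAdj φ p ∂(maxwellian T) =
      ∫ p, trig n ξ θ p * (-(p.2 * FokkerPlanck.dx φ p)) ∂(maxwellian T) +
        ∫ p, trig n ξ θ p * dvAdj (FokkerPlanck.dv φ) p ∂(maxwellian T) := by
    have hv : MemLp (fun p => -(p.2 * FokkerPlanck.dx φ p)) 2 (maxwellian T) := by
      refine (memLp_congr_ae (Eventually.of_forall fun p => ?_)).1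
        (hφ.dx.velocity_mul.memLp (T := T) 2).neg
      simp [mul_comm]
    rw [← integral_add (i0 hv _) (i0 (hφ.dv.memLp_dvAdj 2) _)]
    refine integral_congr_ae (Eventually.of_forall fun p => ?_)
    simp only [fpAdj]
    ring
  have h6 : ∫ p, φ p * genTrig 1 n ξ θ p ∂(maxwellian T) =
      -(freq T n + ξ) * ∫ p, trig n ξ (θ + Real.pi / 2) p * (φ p * p.2) ∂(maxwellian T) -
        ξ ^ 2 * ∫ p, trig n ξ θ p * φ p ∂(maxwellian T) := by
    rw [← integral_const_mul, ← integral_const_mul, ← integral_sub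
      ((i0 (hφ.velocity_mul.memLp 2) _).const_mul _) ((i0 (hφ.memLp 2) _).const_mul _)]
    refine integral_congr_ae (Eventually.of_forall fun p => ?_)
    simp only [genTrig]
    ring
  rw [h5, h6, h1, h2]
  linear_combination ξ * (h4 - h3)

/-! ### Truncation in velocity -/

/-- A smooth compactly supported cutoff on `ℝ`, equal to `1` on `[-1, 1]`. -/
def bump : ContDiffBump (0 : ℝ) := ⟨1, 2, one_pos, one_lt_two⟩

/-- The cutoff at velocities of order `N + 1`. -/
def cutoff (N : ℕ) (v : ℝ) : ℝ := bump (v / (N + 1))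

lemma contDiff_bump : ContDiff ℝ ∞ (bump : ℝ → ℝ) := bump.contDiff

lemma contDiff_cutoff (N : ℕ) : ContDiff ℝ ∞ (cutoff N) :=
  contDiff_bump.comp (contDiff_id.div_const _)

lemma hasDerivAt_cutoff (N : ℕ) (v : ℝ) :
    HasDerivAt (cutoff N) (deriv bump (v / (N + 1)) / (N + 1)) v := by
  have h1 : HasDerivAt (bump : ℝ → ℝ) (deriv bump (v / (N + 1))) (v / (N + 1)) :=
    (contDiff_bump.differentiable (by simp) _).hasDerivAt
  have h2 := h1.comp v ((hasDerivAt_id v).div_const ((N : ℝ) + 1))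
  refine HasDerivAt.congr_deriv (f := cutoff N) h2 ?_
  ring

lemma contDiff_deriv_bump : ContDiff ℝ ∞ (deriv (bump : ℝ → ℝ)) :=
  (contDiff_infty_iff_deriv.1 contDiff_bump).2

lemma hasDerivAt_deriv_cutoff (N : ℕ) (v : ℝ) :
    HasDerivAt (fun w => deriv bump (w / (N + 1)) / ((N : ℝ) + 1))
      (deriv (deriv bump) (v / (N + 1)) / ((N : ℝ) + 1) ^ 2) v := by
  have h1 : HasDerivAt (deriv bump : ℝ → ℝ) (deriv (deriv bump) (v / (N + 1))) (v / (N + 1)) :=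
    (contDiff_deriv_bump.differentiable (by simp) _).hasDerivAt
  have h2 := (h1.comp v ((hasDerivAt_id v).div_const ((N : ℝ) + 1))).div_const ((N : ℝ) + 1)
  refine h2.congr_deriv ?_
  field_simp

lemma exists_bound_deriv_bump : ∃ C, 0 ≤ C ∧ (∀ v, |deriv bump v| ≤ C) ∧
    ∀ v, |deriv (deriv bump) v| ≤ C := by
  obtain ⟨C₁, h1⟩ := bump.hasCompactSupport.deriv.exists_bound_of_continuous
    contDiff_deriv_bump.continuous
  obtain ⟨C₂, h2⟩ := bump.hasCompactSupport.deriv.deriv.exists_bound_of_continuous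
    (contDiff_infty_iff_deriv.1 contDiff_deriv_bump).2.continuous
  exact ⟨max C₁ C₂, ((norm_nonneg _).trans (h1 0)).trans (le_max_left _ _),
    fun v => (h1 v).trans (le_max_left _ _), fun v => (h2 v).trans (le_max_right _ _)⟩

lemma abs_cutoff_le_one (N : ℕ) (v : ℝ) : |cutoff N v| ≤ 1 := by
  rw [cutoff, abs_of_nonneg bump.nonneg]
  exact bump.le_one

lemma tendsto_cutoff (v : ℝ) : Tendsto (fun N => cutoff N v) atTop (𝓝 1) := by
  have h1 : Tendsto (fun N : ℕ => v / ((N : ℝ) + 1)) atTop (𝓝 0) :=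
    tendsto_const_nhds.div_atTop (tendsto_natCast_atTop_atTop.atTop_add tendsto_const_nhds)
  have h2 := (contDiff_bump.continuous.tendsto 0).comp h1
  have h3 : (bump : ℝ → ℝ) 0 = 1 := bump.one_of_mem_closedBall (by simp [bump])
  rwa [h3] at h2

lemma isTest_cutoff_mul_trig (N : ℕ) (n : ℤ) (ξ θ : ℝ) :
    IsTest (fun p : AddCircle T × ℝ => cutoff N p.2 * trig n ξ θ p) := by
  refine IsTest.mul_right (φ := fun p : AddCircle T × ℝ => cutoff N p.2)
    ⟨(contDiff_cutoff N).comp contDiff_snd, ?_⟩ (contDiff_trig n ξ θ)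
  refine HasCompactSupport.intro (K := Set.univ ×ˢ Set.Icc (-(2 * ((N : ℝ) + 1))) (2 * (N + 1)))
    (isCompact_univ.prod isCompact_Icc) fun p hp => ?_
  have hN : (0 : ℝ) < N + 1 := by positivity
  refine bump.zero_of_le_dist ?_
  rw [Real.dist_eq, sub_zero, abs_div, abs_of_pos hN, le_div_iff₀ hN]
  change 2 * ((N : ℝ) + 1) ≤ |p.2|
  by_contra hlt
  exact hp ⟨trivial, abs_le.1 (not_le.1 hlt).le⟩

lemma tendsto_integral_mul_cutoff (f : L2 T) (n : ℤ) (ξ θ : ℝ) :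
    Tendsto (fun N => ∫ p, f p * (cutoff N p.2 * trig n ξ θ p) ∂(maxwellian T)) atTop
      (𝓝 (∫ p, f p * trig n ξ θ p ∂(maxwellian T))) := by
  refine tendsto_integral_of_dominated_convergence (fun p => |f p|)
    (fun N => (integrable_L2_mul f ((isTest_cutoff_mul_trig N n ξ θ).memLp 2)).1)
    ((Lp.memLp f).integrable (by norm_num)).abs
    (fun N => Eventually.of_forall fun p => ?_) (Eventually.of_forall fun p => ?_)
  · rw [Real.norm_eq_abs, abs_mul, abs_mul]
    exact mul_le_of_le_one_right (abs_nonneg _)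
      (mul_le_one₀ (abs_cutoff_le_one N p.2) (abs_nonneg _) (abs_trig_le_one n ξ θ p))
  · simpa using ((tendsto_cutoff p.2).mul_const (trig n ξ θ p)).const_mul (f p)

/-- Test functions separate the points of `L²`. -/
lemma eq_of_forall_test {f g : L2 T} (h : ∀ φ : AddCircle T × ℝ → ℝ, IsTest φ →
    ∫ p, f p * φ p ∂(maxwellian T) = ∫ p, g p * φ p ∂(maxwellian T)) : f = g := by
  refine ext_integral_trig fun n ξ θ => ?_
  refine tendsto_nhds_unique (tendsto_integral_mul_cutoff f n ξ θ) ?_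
  simp only [h _ (isTest_cutoff_mul_trig _ n ξ θ)]
  exact tendsto_integral_mul_cutoff g n ξ θ

lemma fpAdj_cutoff_mul_trig (N : ℕ) (n : ℤ) (ξ θ : ℝ) (p : AddCircle T × ℝ) :
    fpAdj (fun p : AddCircle T × ℝ => cutoff N p.2 * trig n ξ θ p) p =
      cutoff N p.2 * (-genTrig (-1) n ξ θ p) +
      (deriv bump (p.2 / (N + 1)) / (N + 1) *
        (p.2 * trig n ξ θ p - 2 * ξ * trig n ξ (θ + Real.pi / 2) p) -
      deriv (deriv bump) (p.2 / (N + 1)) / ((N : ℝ) + 1) ^ 2 * trig n ξ θ p) := by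
  have h1 : ∀ p : AddCircle T × ℝ, dv (fun p : AddCircle T × ℝ => cutoff N p.2 * trig n ξ θ p) p =
      deriv bump (p.2 / (N + 1)) / (N + 1) * trig n ξ θ p +
        cutoff N p.2 * (ξ * trig n ξ (θ + Real.pi / 2) p) := fun p =>
    ((hasDerivAt_cutoff N p.2).mul (hasDerivAt_trig_velocity n ξ θ p.1 p.2)).deriv
  have h2 : dv (dv (fun p : AddCircle T × ℝ => cutoff N p.2 * trig n ξ θ p)) p =
      (deriv (deriv bump) (p.2 / (N + 1)) / ((N : ℝ) + 1) ^ 2 * trig n ξ θ p +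
        deriv bump (p.2 / (N + 1)) / (N + 1) * (ξ * trig n ξ (θ + Real.pi / 2) p)) +
      (deriv bump (p.2 / (N + 1)) / (N + 1) * (ξ * trig n ξ (θ + Real.pi / 2) p) +
        cutoff N p.2 * (ξ * (ξ * trig n ξ (θ + Real.pi / 2 + Real.pi / 2) p))) := by
    rw [funext h1]
    exact (((hasDerivAt_deriv_cutoff N p.2).mul (hasDerivAt_trig_velocity n ξ θ p.1 p.2)).add
      ((hasDerivAt_cutoff N p.2).mul
        ((hasDerivAt_trig_velocity n ξ (θ + Real.pi / 2) p.1 p.2).const_mul ξ))).deriv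
  have h3 : dx (fun p : AddCircle T × ℝ => cutoff N p.2 * trig n ξ θ p) p =
      cutoff N p.2 * (freq T n * trig n ξ (θ + Real.pi / 2) p) := by
    obtain ⟨x, v, rfl⟩ := exists_coe_eq p
    exact ((isTest_cutoff_mul_trig N n ξ θ).hasDerivAt_position x v).unique
      ((hasDerivAt_trig_position n ξ θ x v).const_mul (cutoff N v))
  simp only [fpAdj, dvAdj, h2, h3, h1, genTrig, trig_add_pi]
  ring

/-- The weak equation `P f = g` may be tested against trigonometric functions. -/
lemma IsFP.integral_mul_genTrig {f g : L2 T} (h : IsFP f g) (n : ℤ) (ξ θ : ℝ) :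
    ∫ p, f p * (-genTrig (-1) n ξ θ p) ∂(maxwellian T) =
      ∫ p, g p * trig n ξ θ p ∂(maxwellian T) := by
  refine tendsto_nhds_unique ?_ (tendsto_integral_mul_cutoff g n ξ θ)
  simp only [← h _ (isTest_cutoff_mul_trig _ n ξ θ)]
  obtain ⟨C, hC0, hC1, hC2⟩ := exists_bound_deriv_bump
  have hb : MemLp (fun p : AddCircle T × ℝ =>
      |genTrig (-1) n ξ θ p| + (C * (|p.2| + 2 * |ξ|) + C)) 2 (maxwellian T) := by
    have h1 := (memLp_genTrig (T := T) (-1) n ξ θ).abs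
    have h2 := (memLp_velocity (T := T)).abs
    exact h1.add (((h2.add (memLp_const _)).const_mul C).add (memLp_const _))
  refine tendsto_integral_of_dominated_convergence (fun p => ‖f p *
      (|genTrig (-1) n ξ θ p| + (C * (|p.2| + 2 * |ξ|) + C))‖)
    (fun N => (integrable_L2_mul f ((isTest_cutoff_mul_trig N n ξ θ).memLp_fpAdj 2)).1)
    (integrable_L2_mul f hb).norm
    (fun N => Eventually.of_forall fun p => ?_) (Eventually.of_forall fun p => ?_)
  · rw [norm_mul, norm_mul]
    refine mul_le_mul_of_nonneg_left ?_ (norm_nonneg _)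
    rw [Real.norm_eq_abs, Real.norm_eq_abs, abs_of_nonneg (a := |genTrig (-1) n ξ θ p| + _)
      (by positivity), fpAdj_cutoff_mul_trig]
    have hN : (1 : ℝ) ≤ N + 1 := by
      have : (0 : ℝ) ≤ N := N.cast_nonneg
      linarith
    have t1 := abs_trig_le_one n ξ θ p
    have t2 := abs_trig_le_one n ξ (θ + Real.pi / 2) p
    refine (abs_add_le _ _).trans (add_le_add ?_ ((abs_sub _ _).trans (add_le_add ?_ ?_)))
    · rw [abs_mul, abs_neg]
      exact mul_le_of_le_one_left (abs_nonneg _) (abs_cutoff_le_one N p.2)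
    · rw [abs_mul, abs_div, abs_of_pos (by linarith : (0 : ℝ) < N + 1)]
      refine mul_le_mul ((div_le_self (abs_nonneg _) hN).trans (hC1 _)) ?_ (abs_nonneg _) hC0
      refine (abs_sub _ _).trans (add_le_add ?_ ?_)
      · rw [abs_mul]
        exact mul_le_of_le_one_right (abs_nonneg _) t1
      · rw [abs_mul, abs_mul, abs_two]
        exact mul_le_of_le_one_right (by positivity) t2
    · rw [abs_mul, abs_div, abs_of_pos (by positivity : (0 : ℝ) < ((N : ℝ) + 1) ^ 2)]
      refine (mul_le_of_le_one_right (by positivity) t1).trans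
        ((div_le_self (abs_nonneg _) ?_).trans (hC2 _))
      nlinarith
  · refine Tendsto.const_mul (f p) ?_
    simp only [fpAdj_cutoff_mul_trig]
    have hN : Tendsto (fun N : ℕ => (N : ℝ) + 1) atTop atTop :=
      tendsto_natCast_atTop_atTop.atTop_add tendsto_const_nhds
    have d1 : Tendsto (fun N : ℕ => deriv bump (p.2 / ((N : ℝ) + 1)) / ((N : ℝ) + 1)) atTop
        (𝓝 0) := by
      refine squeeze_zero_norm (fun N => ?_) (tendsto_const_nhds (x := C).div_atTop hN)
      rw [norm_div, Real.norm_eq_abs, Real.norm_eq_abs,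
        abs_of_pos (by positivity : (0 : ℝ) < (N : ℝ) + 1)]
      gcongr
      exact hC1 _
    have d2 : Tendsto (fun N : ℕ => deriv (deriv bump) (p.2 / ((N : ℝ) + 1)) / ((N : ℝ) + 1) ^ 2)
        atTop (𝓝 0) := by
      refine squeeze_zero_norm (fun N => ?_) (tendsto_const_nhds (x := C).div_atTop
        ((tendsto_pow_atTop two_ne_zero).comp hN))
      rw [norm_div, Real.norm_eq_abs, Real.norm_eq_abs,
        abs_of_pos (by positivity : (0 : ℝ) < ((N : ℝ) + 1) ^ 2)]
      simp only [Function.comp_apply]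
      gcongr
      exact hC2 _
    simpa using ((tendsto_cutoff p.2).mul_const (-genTrig (-1) n ξ θ p)).add
      ((d1.mul_const (p.2 * trig n ξ θ p - 2 * ξ * trig n ξ (θ + Real.pi / 2) p)).sub
        (d2.mul_const (trig n ξ θ p)))

end TestFunctions

section Generator

variable {T : ℝ} [Fact (0 < T)]

/-! ### The generator -/

lemma inner_trigL_toLp {u : AddCircle T × ℝ → ℝ} (hu : MemLp u 2 (maxwellian T)) (n : ℤ)
    (ξ θ : ℝ) :
    inner ℝ (trigL T n ξ θ) (hu.toLp u) = ∫ p, trig n ξ θ p * u p ∂(maxwellian T) := by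
  rw [inner_toLp]
  refine integral_congr_ae ?_
  filter_upwards [(memLp_trig (T := T) n ξ θ 2).coeFn_toLp] with p hp
  rw [trigL, hp]

/-- The generator of `fpSemigroup 1` is exactly `-P`, with its maximal distributional domain. -/
lemma isFPSemigroup_fpSemigroup : IsFPSemigroup (T := T) (fpSemigroup 1) where
  zero := fpSemigroup_zero 1
  add := fun _ _ hs ht => fpSemigroup_add 1 hs ht
  continuous := tendsto_fpSemigroup 1
  generator := by
    intro f g
    constructor
    · intro hlim φ hφ
      set Φ : L2 T := (hφ.memLp 2).toLp φ with hΦ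
      set Ψ : L2 T := (hφ.memLp_fpAdj 2).toLp _ with hΨ
      -- the test function is in the domain of the generator of the adjoint semigroup
      have hadj : Tendsto (fun t : ℝ => t⁻¹ • (fpSemigroup (-1) t Φ - Φ)) (𝓝[>] 0) (𝓝 (-Ψ)) := by
        refine tendsto_diffQuot_fpSemigroup fun n ξ θ => ?_
        rw [neg_neg, ← inner_trigL, inner_neg_left, real_inner_comm, inner_trigL_toLp,
          hφ.integral_trig_mul_fpAdj, neg_neg]
        refine integral_congr_ae ?_
        filter_upwards [(hφ.memLp (T := T) 2).coeFn_toLp] with p hp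
        rw [hΦ, hp]
      have h1 : Tendsto (fun t : ℝ => inner ℝ (t⁻¹ • (fpSemigroup 1 t f - f)) Φ) (𝓝[>] 0)
          (𝓝 (inner ℝ g Φ)) := hlim.inner tendsto_const_nhds
      have h2 : Tendsto (fun t : ℝ => inner ℝ (t⁻¹ • (fpSemigroup 1 t f - f)) Φ) (𝓝[>] 0)
          (𝓝 (inner ℝ f (-Ψ))) := by
        refine (tendsto_const_nhds.inner hadj).congr' ?_
        filter_upwards [self_mem_nhdsWithin] with t ht
        rw [real_inner_smul_left, real_inner_smul_right, inner_sub_left, inner_sub_right,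
          inner_fpSemigroup_left (le_of_lt ht)]
      have h3 := tendsto_nhds_unique h1 h2
      rw [inner_neg_right] at h3
      rw [← inner_toLp f (hφ.memLp_fpAdj 2), ← inner_toLp (-g) (hφ.memLp 2), inner_neg_left]
      linarith
    · intro h
      refine tendsto_diffQuot_fpSemigroup fun n ξ θ => ?_
      have h1 := h.integral_mul_genTrig n ξ θ
      rw [← inner_trigL, inner_neg_left, inner_trigL] at h1
      simp only [mul_neg, integral_neg] at h1
      linarith

lemma isFP_trigL (n : ℤ) (ξ θ : ℝ) :
    IsFP (trigL T n ξ θ) (-(memLp_genTrig (T := T) 1 n ξ θ).toLp _) := by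
  intro φ hφ
  rw [← inner_toLp _ (hφ.memLp_fpAdj 2), inner_trigL_toLp, hφ.integral_trig_mul_fpAdj,
    ← inner_toLp _ (hφ.memLp 2), inner_neg_left, real_inner_comm, inner_toLp]
  congr 1
  refine integral_congr_ae ?_
  filter_upwards [(hφ.memLp (T := T) 2).coeFn_toLp] with p hp
  rw [hp]

/-! ### Uniqueness of the semigroup -/

section Uniqueness

variable {S : ℝ → L2 T →L[ℝ] L2 T}

/-- By the uniform boundedness principle, a strongly continuous semigroup is bounded near `0`. -/
lemma IsFPSemigroup.exists_bound_near_zero (hS : IsFPSemigroup S) :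
    ∃ δ > 0, ∃ M, 1 ≤ M ∧ ∀ t, 0 ≤ t → t ≤ δ → ‖S t‖ ≤ M := by
  by_contra! hcon
  have hex : ∀ n : ℕ, ∃ t, 0 ≤ t ∧ t ≤ 1 / ((n : ℝ) + 1) ∧ (n : ℝ) + 1 < ‖S t‖ := fun n =>
    hcon (1 / ((n : ℝ) + 1)) (by positivity) (n + 1) (by
      have : (0 : ℝ) ≤ n := n.cast_nonneg
      linarith)
  choose τ h0 h1 h2 using hex
  have hpos : ∀ n, 0 < τ n := by
    intro n
    refine (h0 n).lt_of_ne fun h => ?_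
    have h3 := h2 n
    rw [← h, hS.zero] at h3
    have h4 := ContinuousLinearMap.norm_id_le (𝕜 := ℝ) (E := L2 T)
    have : (0 : ℝ) ≤ n := n.cast_nonneg
    linarith
  have hlim : Tendsto τ atTop (𝓝[>] 0) := tendsto_nhdsWithin_iff.2
    ⟨squeeze_zero h0 h1 tendsto_one_div_add_atTop_nhds_zero_nat, Eventually.of_forall hpos⟩
  obtain ⟨C, hC⟩ := banach_steinhaus (g := fun n => S (τ n)) fun f => by
    obtain ⟨C, hC⟩ := ((hS.continuous f).comp hlim).norm.bddAbove_range
    exact ⟨C, fun n => hC ⟨n, rfl⟩⟩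
  obtain ⟨n, hn⟩ := exists_nat_gt C
  have h5 := hC n
  have h6 := h2 n
  linarith

lemma IsFPSemigroup.exists_bound (hS : IsFPSemigroup S) (a : ℝ) :
    ∃ M, 0 ≤ M ∧ ∀ t, 0 ≤ t → t ≤ a → ‖S t‖ ≤ M := by
  obtain ⟨δ, hδ, M, hM, hb⟩ := hS.exists_bound_near_zero
  have hn : ∀ n : ℕ, ∀ t, 0 ≤ t → t ≤ n * δ → ‖S t‖ ≤ M ^ n * M := by
    intro n
    induction n with
    | zero =>
      intro t h0 h1
      simpa using hb t h0 (h1.trans (by simpa using hδ.le))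
    | succ n ih =>
      intro t h0 h1
      by_cases hle : t ≤ δ
      · exact (hb t h0 hle).trans (le_mul_of_one_le_left (by linarith) (one_le_pow₀ hM))
      · have h2 : S t = (S δ).comp (S (t - δ)) := by
          rw [← hS.add _ _ hδ.le (by linarith), add_sub_cancel]
        push_cast at h1
        calc ‖S t‖ ≤ ‖S δ‖ * ‖S (t - δ)‖ := h2 ▸ ContinuousLinearMap.opNorm_comp_le _ _
          _ ≤ M * (M ^ n * M) := mul_le_mul (hb δ hδ.le le_rfl)
              (ih (t - δ) (by linarith) (by linarith)) (norm_nonneg _) (by linarith)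
          _ = M ^ (n + 1) * M := by ring
  obtain ⟨n, hna⟩ := exists_nat_gt (a / δ)
  refine ⟨M ^ n * M, by positivity, fun t h0 h1 => hn n t h0 (h1.trans ?_)⟩
  rw [div_lt_iff₀ hδ] at hna
  exact hna.le

lemma IsFPSemigroup.continuousOn (hS : IsFPSemigroup S) (f : L2 T) :
    ContinuousOn (fun t => S t f) (Set.Ici 0) := by
  have hρ : Tendsto (fun h : ℝ => S |h| f) (𝓝 0) (𝓝 f) := by
    rw [← nhdsNE_sup_pure, tendsto_sup]
    refine ⟨(hS.continuous f).comp (tendsto_nhdsWithin_iff.2 ⟨?_, ?_⟩), ?_⟩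
    · refine Tendsto.mono_left ?_ nhdsWithin_le_nhds
      simpa using (continuous_abs.tendsto (0 : ℝ))
    · filter_upwards [self_mem_nhdsWithin] with h hh
      exact abs_pos.2 hh
    · rw [tendsto_pure_left]
      intro s hs
      rw [abs_zero, hS.zero]
      exact mem_of_mem_nhds hs
  intro t ht
  obtain ⟨M, hM0, hM⟩ := hS.exists_bound (t + 1)
  -- both one-sided estimates come from factoring out the smaller time
  have hle : ∀ s r, 0 ≤ s → s ≤ r → r ≤ t + 1 → ‖S r f - S s f‖ ≤ M * ‖S |r - s| f - f‖ := by
    intro s r h0 h1 h2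
    have h3 : S r = (S s).comp (S (r - s)) := by
      rw [← hS.add _ _ h0 (by linarith), add_sub_cancel]
    rw [h3, ContinuousLinearMap.comp_apply, ← map_sub, abs_of_nonneg (by linarith)]
    exact ((S s).le_opNorm _).trans
      (mul_le_mul_of_nonneg_right (hM s h0 (by linarith)) (norm_nonneg _))
  rw [ContinuousWithinAt, tendsto_iff_norm_sub_tendsto_zero]
  have hlim : Tendsto (fun s => M * ‖S |s - t| f - f‖) (𝓝[Set.Ici 0] t) (𝓝 0) := by
    have h1 : Tendsto (fun s => s - t) (𝓝[Set.Ici 0] t) (𝓝 0) := by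
      have : Tendsto (fun s => s - t) (𝓝 t) (𝓝 (t - t)) :=
        (continuous_id.sub continuous_const).tendsto t
      rw [sub_self] at this
      exact this.mono_left nhdsWithin_le_nhds
    have h2 := (tendsto_iff_norm_sub_tendsto_zero.1 (hρ.comp h1)).const_mul M
    simpa using h2
  refine squeeze_zero' (Eventually.of_forall fun s => norm_nonneg _) ?_ hlim
  filter_upwards [self_mem_nhdsWithin, nhdsWithin_le_nhds (eventually_lt_nhds (lt_add_one t))]
    with s hs hs1
  rcases le_total s t with h | h
  · rw [norm_sub_rev, abs_sub_comm]
    exact hle s t hs h (by linarith)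
  · exact hle t s ht h hs1.le

lemma IsFPSemigroup.tendsto_diffQuot_orbit (hS : IsFPSemigroup S) {f g : L2 T}
    (h : Tendsto (fun h : ℝ => h⁻¹ • (S h f - f)) (𝓝[>] 0) (𝓝 g)) {t : ℝ} (ht : 0 ≤ t) :
    Tendsto (fun h : ℝ => h⁻¹ • (S h (S t f) - S t f)) (𝓝[>] 0) (𝓝 (S t g)) := by
  refine (((S t).continuous.tendsto g).comp h).congr' ?_
  filter_upwards [self_mem_nhdsWithin] with s hs
  have hs' : 0 ≤ s := le_of_lt hs
  rw [Function.comp_apply, map_smul, map_sub, ← ContinuousLinearMap.comp_apply,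
    ← ContinuousLinearMap.comp_apply, ← hS.add t s ht hs', ← hS.add s t hs' ht, add_comm]

lemma IsFPSemigroup.hasDerivWithinAt_orbit (hS : IsFPSemigroup S) {f g : L2 T}
    (h : Tendsto (fun h : ℝ => h⁻¹ • (S h f - f)) (𝓝[>] 0) (𝓝 g)) {t : ℝ} (ht : 0 ≤ t) :
    HasDerivWithinAt (fun s => S s f) (S t g) (Set.Ici t) t := by
  rw [← hasDerivWithinAt_Ioi_iff_Ici, hasDerivWithinAt_iff_tendsto_slope' (by simp)]
  have h1 : Tendsto (fun s => s - t) (𝓝[>] t) (𝓝[>] 0) := by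
    refine tendsto_nhdsWithin_iff.2 ⟨?_, ?_⟩
    · have : Tendsto (fun s => s - t) (𝓝 t) (𝓝 (t - t)) :=
        (continuous_id.sub continuous_const).tendsto t
      rw [sub_self] at this
      exact this.mono_left nhdsWithin_le_nhds
    · filter_upwards [self_mem_nhdsWithin] with s hs
      exact sub_pos.2 (Set.mem_Ioi.1 hs)
  refine ((hS.tendsto_diffQuot_orbit h ht).comp h1).congr' ?_
  filter_upwards [self_mem_nhdsWithin] with s hs
  have hs' : t < s := hs
  rw [Function.comp_apply, ← ContinuousLinearMap.comp_apply, ← hS.add _ _ (by linarith) ht,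
    sub_add_cancel, slope_def_module]

/-- The generator is dissipative, because the semigroup consists of contractions. -/
lemma inner_generator_nonpos {f g : L2 T}
    (h : Tendsto (fun h : ℝ => h⁻¹ • (fpSemigroup 1 h f - f)) (𝓝[>] 0) (𝓝 g)) :
    inner ℝ f g ≤ 0 := by
  refine le_of_tendsto (tendsto_const_nhds.inner h) ?_
  filter_upwards [self_mem_nhdsWithin] with t ht
  rw [real_inner_smul_right, inner_sub_right, real_inner_self_eq_norm_sq]
  refine mul_nonpos_of_nonneg_of_nonpos (inv_nonneg.2 (le_of_lt ht)) ?_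
  have h1 := real_inner_le_norm f (fpSemigroup 1 t f)
  have h2 := norm_fpSemigroup_le 1 t f
  nlinarith [norm_nonneg f]

/-- The semigroup is determined by its generator: the difference of two orbits starting in the
domain solves the equation with zero initial datum, and the generator is dissipative. -/
lemma IsFPSemigroup.eq_fpSemigroup (hS : IsFPSemigroup S) {t : ℝ} (ht : 0 ≤ t) :
    S t = fpSemigroup 1 t := by
  have hR := isFPSemigroup_fpSemigroup (T := T)
  refine clm_ext_trig fun n ξ θ => ?_
  set e := trigL T n ξ θ
  set g : L2 T := (memLp_genTrig (T := T) 1 n ξ θ).toLp _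
  have hSe := (hS.generator e g).2 (isFP_trigL n ξ θ)
  have hRe := (hR.generator e g).2 (isFP_trigL n ξ θ)
  have hsub : Set.Icc 0 t ⊆ Set.Ici 0 := Set.Icc_subset_Ici_self
  have hle := image_le_of_deriv_right_le_deriv_boundary
    (f := fun s => ‖S s e - fpSemigroup 1 s e‖ ^ 2)
    (f' := fun s => 2 * inner ℝ (S s e - fpSemigroup 1 s e) (S s g - fpSemigroup 1 s g))
    (a := 0) (b := t) (B := fun _ => 0) (B' := fun _ => 0)
    ((((hS.continuousOn e).sub (hR.continuousOn e)).mono hsub).norm.pow 2)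
    (fun s hs => ((hS.hasDerivWithinAt_orbit hSe hs.1).sub
      (hR.hasDerivWithinAt_orbit hRe hs.1)).norm_sq)
    (by simp [hS.zero, hR.zero]) continuousOn_const
    (fun s _ => hasDerivWithinAt_const _ _ _)
    (fun s hs => by
      -- the orbit of `S` stays in the domain, which is that of the generator of `fpSemigroup 1`
      have h1 := (hR.generator _ _).2 ((hS.generator _ _).1 (hS.tendsto_diffQuot_orbit hSe hs.1))
      have h2 := h1.sub (hR.tendsto_diffQuot_orbit hRe hs.1)
      have h3 : inner ℝ (S s e - fpSemigroup 1 s e) (S s g - fpSemigroup 1 s g) ≤ 0 := by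
        refine inner_generator_nonpos (h2.congr fun h => ?_)
        rw [← smul_sub, map_sub]
        congr 1
        abel
      linarith)
    (Set.right_mem_Icc.2 ht)
  rw [← sub_eq_zero, ← norm_eq_zero]
  exact pow_eq_zero_iff two_ne_zero |>.1 (le_antisymm hle (by positivity))

end Uniqueness

/-! ### Regularization -/

/-- The noise weight which realizes `∂ₓ` on `fpSemigroup 1 t`. -/
def weightDx (t : ℝ) : ℝ × ℝ × ℝ := (0, 1 / posStd t, 0)

/-- The noise weight which realizes `∂ᵥ` on `fpSemigroup 1 t`. -/
def weightDv (t : ℝ) : ℝ × ℝ × ℝ :=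
  (0, -(1 - Real.exp (-t)) / ((1 + Real.exp (-t)) * posStd t), Real.exp (-t) / velStd t)

/-- An integral identity between two bounded operators extends from trigonometric functions. -/
lemma integral_eq_of_trigL {A B : L2 T →L[ℝ] L2 T} {u w : AddCircle T × ℝ → ℝ}
    (hu : MemLp u 2 (maxwellian T)) (hw : MemLp w 2 (maxwellian T))
    (h : ∀ n ξ θ, inner ℝ (A (trigL T n ξ θ)) (hu.toLp u) =
      inner ℝ (B (trigL T n ξ θ)) (hw.toLp w)) (f : L2 T) :
    ∫ p, A f p * u p ∂(maxwellian T) = ∫ p, B f p * w p ∂(maxwellian T) := by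
  rw [← inner_toLp _ hu, ← inner_toLp _ hw, real_inner_comm, real_inner_comm (hw.toLp w)]
  have heq : (innerSL ℝ (hu.toLp u)).comp A = (innerSL ℝ (hw.toLp w)).comp B := by
    refine clm_ext_trig fun n ξ θ => ?_
    simp only [ContinuousLinearMap.comp_apply, innerSL_apply_apply]
    rw [real_inner_comm, h, real_inner_comm]
  exact congrArg (fun L : L2 T →L[ℝ] ℝ => L f) heq

/-- Gaussian integration by parts: the derivative of the average is an average with a weight. -/
lemma isWeakDx_flowAverage {t : ℝ} (ht : 0 < t) (f : L2 T) :
    IsWeakDx (fpSemigroup 1 t f) (flowAverage 1 t (weightDx t) f) := by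
  intro φ hφ
  refine integral_eq_of_trigL (hφ.dx.memLp 2).neg (hφ.memLp 2) (fun n ξ θ => ?_) f
  have hr := (posStd_pos ht).ne'
  rw [fpSemigroup_trigL ht.le, flowAverage_trigL ht.le, real_inner_smul_left, real_inner_smul_left,
    inner_add_left, real_inner_smul_left, real_inner_smul_left, inner_trigL_toLp,
    inner_trigL_toLp, inner_trigL_toLp]
  have h1 := hφ.integral_trig_mul_dx n (shiftFreq (1 * freq T n) ξ t) θ
  simp only [Pi.neg_apply]
  rw [h1]
  simp only [weightDx]
  field_simp
  ring

lemma isWeakDv_flowAverage {t : ℝ} (ht : 0 < t) (f : L2 T) :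
    IsWeakDv (fpSemigroup 1 t f) (flowAverage 1 t (weightDv t) f) := by
  intro φ hφ
  refine integral_eq_of_trigL (hφ.memLp_dvAdj 2) (hφ.memLp 2) (fun n ξ θ => ?_) f
  have hr := (posStd_pos ht).ne'
  have hd := (velStd_pos ht).ne'
  have hq : 1 + Real.exp (-t) ≠ 0 := by positivity
  rw [fpSemigroup_trigL ht.le, flowAverage_trigL ht.le, real_inner_smul_left, real_inner_smul_left,
    inner_add_left, real_inner_smul_left, real_inner_smul_left, inner_trigL_toLp,
    inner_trigL_toLp, inner_trigL_toLp, hφ.integral_trig_mul_dvAdj]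
  have h1 : (weightDv t).2.1 * (1 * freq T n * posStd t) +
      (weightDv t).2.2 * (1 * freq T n * crossCoeff t + ξ * velStd t) =
      shiftFreq (1 * freq T n) ξ t := by
    simp only [weightDv, crossCoeff, shiftFreq]
    have h2 := velStd_sq ht.le
    field_simp
    rw [h2]
    ring
  rw [h1]
  simp [weightDv]

lemma IsWeakDx.unique {f g g' : L2 T} (h : IsWeakDx f g) (h' : IsWeakDx f g') : g = g' :=
  eq_of_forall_test fun φ hφ => (h φ hφ).symm.trans (h' φ hφ)

lemma IsWeakDv.unique {f g g' : L2 T} (h : IsWeakDv f g) (h' : IsWeakDv f g') : g = g' :=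
  eq_of_forall_test fun φ hφ => (h φ hφ).symm.trans (h' φ hφ)

lemma one_div_posStd_sq_le {t : ℝ} (h0 : 0 < t) (h1 : t ≤ 1) :
    1 / posStd t ^ 2 ≤ 24 / t ^ 3 := by
  rw [div_le_div_iff₀ (pow_pos (posStd_pos h0) 2) (by positivity)]
  linarith [posStd_sq_ge h0.le h1]

lemma norm_weightDx_le {t : ℝ} (h0 : 0 < t) (h1 : t ≤ 1) :
    Real.sqrt ((weightDx t).1 ^ 2 + (weightDx t).2.1 ^ 2 + (weightDx t).2.2 ^ 2) ≤
      6 / t ^ (3 / 2 : ℝ) := by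
  have hsq : (t ^ (3 / 2 : ℝ)) ^ 2 = t ^ 3 := by
    rw [← Real.rpow_natCast, ← Real.rpow_mul h0.le, ← Real.rpow_natCast]
    norm_num
  refine Real.sqrt_le_iff.2 ⟨by positivity, ?_⟩
  rw [div_pow, hsq]
  simp only [weightDx, div_pow, one_pow]
  have h3 : 24 / t ^ 3 ≤ 6 ^ 2 / t ^ 3 := by gcongr; norm_num
  have := one_div_posStd_sq_le h0 h1
  linarith

/-- The weight for `∂ᵥ` is small, although `1 / posStd t` is of order `t^(-3/2)`: the position enters
with the factor `1 - exp (-t)`, which is at most `t`. -/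
lemma norm_weightDv_le {t : ℝ} (h0 : 0 < t) (h1 : t ≤ 1) :
    Real.sqrt ((weightDv t).1 ^ 2 + (weightDv t).2.1 ^ 2 + (weightDv t).2.2 ^ 2) ≤
      6 / t ^ (1 / 2 : ℝ) := by
  have hsq : (t ^ (1 / 2 : ℝ)) ^ 2 = t := by
    rw [← Real.rpow_natCast, ← Real.rpow_mul h0.le]
    norm_num
  refine Real.sqrt_le_iff.2 ⟨by positivity, ?_⟩
  rw [div_pow, hsq]
  have hq0 := Real.exp_pos (-t)
  have hq1 : Real.exp (-t) ≤ 1 := Real.exp_le_one_iff.2 (by linarith)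
  have hlow := one_sub_exp_neg_ge h0.le h1
  have hup : 1 - Real.exp (-t) ≤ t := by linarith [Real.add_one_le_exp (-t)]
  have ha : (Real.exp (-t) / velStd t) ^ 2 ≤ 2 / t := by
    rw [div_pow, velStd_sq h0.le, div_le_div_iff₀ (by nlinarith) h0]
    have h2 : Real.exp (-t) ^ 2 ≤ Real.exp (-t) := pow_le_of_le_one hq0.le hq1 two_ne_zero
    have h3 : Real.exp (-t) ^ 2 * t ≤ 1 * t := by gcongr; linarith
    linarith
  have hb : (-(1 - Real.exp (-t)) / ((1 + Real.exp (-t)) * posStd t)) ^ 2 ≤ 24 / t := by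
    have h2 : (-(1 - Real.exp (-t)) / ((1 + Real.exp (-t)) * posStd t)) ^ 2 =
        ((1 - Real.exp (-t)) / (1 + Real.exp (-t))) ^ 2 * (1 / posStd t ^ 2) := by
      have hr := (posStd_pos h0).ne'
      field_simp
    have h3 : (1 - Real.exp (-t)) / (1 + Real.exp (-t)) ≤ t := by
      rw [div_le_iff₀ (by linarith)]
      nlinarith
    have h4 : 0 ≤ (1 - Real.exp (-t)) / (1 + Real.exp (-t)) :=
      div_nonneg (by linarith) (by linarith)
    rw [h2]
    calc _ ≤ t ^ 2 * (24 / t ^ 3) :=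
          mul_le_mul (pow_le_pow_left₀ h4 h3 2) (one_div_posStd_sq_le h0 h1) (by positivity)
            (by positivity)
      _ = 24 / t := by field_simp
  have hc : 2 / t + 24 / t ≤ 6 ^ 2 / t := by
    rw [← add_div]
    gcongr
    norm_num
  simp only [weightDv] at ha hb ⊢
  linarith

end Generator

end FokkerPlanck

end

theorem theorem1p2 (T : ℝ) [Fact (0 < T)] :
    (∃ S : ℝ → FokkerPlanck.L2 T →L[ℝ] FokkerPlanck.L2 T, FokkerPlanck.IsFPSemigroup S) ∧
    ∃ C : ℝ, 0 < C ∧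
      ∀ S : ℝ → FokkerPlanck.L2 T →L[ℝ] FokkerPlanck.L2 T, FokkerPlanck.IsFPSemigroup S →
      ∀ f₀ : FokkerPlanck.L2 T,
        (∀ t : ℝ, 0 < t → FokkerPlanck.MemH1 (S t f₀)) ∧
        (∀ t : ℝ, 0 < t → t ≤ 1 →
          (∀ g : FokkerPlanck.L2 T, FokkerPlanck.IsWeakDv (S t f₀) g →
            ‖g‖ ≤ C / t ^ (1 / 2 : ℝ) * ‖f₀‖) ∧
          (∀ g : FokkerPlanck.L2 T, FokkerPlanck.IsWeakDx (S t f₀) g →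
            ‖g‖ ≤ C / t ^ (3 / 2 : ℝ) * ‖f₀‖)) := by
  refine ⟨⟨_, FokkerPlanck.isFPSemigroup_fpSemigroup⟩, 6, by norm_num, fun S hS f₀ =>
    ⟨fun t ht => ?_, fun t ht ht1 => ⟨fun g hg => ?_, fun g hg => ?_⟩⟩⟩
  · rw [hS.eq_fpSemigroup ht.le]
    exact ⟨⟨_, FokkerPlanck.isWeakDx_flowAverage ht f₀⟩,
      ⟨_, FokkerPlanck.isWeakDv_flowAverage ht f₀⟩⟩
  · rw [hS.eq_fpSemigroup ht.le] at hg
    rw [hg.unique (FokkerPlanck.isWeakDv_flowAverage ht f₀)]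
    exact (FokkerPlanck.norm_flowAverage_le _ _ _ _).trans
      (mul_le_mul_of_nonneg_right (FokkerPlanck.norm_weightDv_le ht ht1) (norm_nonneg _))
  · rw [hS.eq_fpSemigroup ht.le] at hg
    rw [hg.unique (FokkerPlanck.isWeakDx_flowAverage ht f₀)]
    exact (FokkerPlanck.norm_flowAverage_le _ _ _ _).trans
      (mul_le_mul_of_nonneg_right (FokkerPlanck.norm_weightDx_le ht ht1) (norm_nonneg _))
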